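/- **Theorem 2.** Consider a linear time-invariant system $\Sigma$: $\mathcal D x(t)=Ax(t)+Bu(t)$, $y(t)=Cx(t)+Du(t)$ with real matrices, $x(t)\in\mathbb R^n$, $u(t)\in\mathbb R^m$, $y(t)\in\mathbb R^p$, in continuous time ($t\in\mathbb R^+$, $\mathcal Dx=\dot x$) or in discrete time ($t\in\mathbb N$, $\mathcal Dx(t)=x(t+1)$). Let $\mathbb C_g$ be the open left half-plane, respectively the open unit disc; a real square matrix is asymptotically stable if its eigenvalues lie in $\mathbb C_g$. Call $\rho\in\mathbb R$ an admissible rate if $\rho<0$, respectively $0<\rho<1$. Let $P(\lambda)=\begin{bmatrix}A-\lambda I&B\\C&D\end{bmatrix}$; its normal rank is $\max_{\mu\in\mathbb C}\operatorname{rank}P(\mu)$, and the invariant zeros of $\Sigma$ are the $z\in\mathbb C$ at which $P(z)$ has rank smaller than the normal rank. The algebraic multiplicity of an invariant zero $z$ is its multiplicity as a root of the product of the nonzero diagonal entries of the Smith form of $P(\lambda)$. Subspaces. A friend of a subspace $V\subseteq\mathbb R^n$ is a matrix $F$ with $(A+BF)V\subseteq V\subseteq\ker(C+DF)$. Let $\mathcal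 V^\star$ be the largest subspace that has a friend; let $\mathcal V_g^\star$ be the largest subspace $V$ that has a friend $F$ for which all eigenvalues of $(A+BF)|_V$ lie in $\mathbb C_g$; let $\mathcal R^\star$ be the smallest $(A+BF)$-invariant subspace containing $\mathcal V^\star\cap B\ker D$, where $F$ is a friend of $\mathcal V^\star$ ($\mathcal R^\star$ does not depend on its choice). For $1\le j\le p$ let $\Sigma_j=(A,B,C_{(j)},D_{(j)})$ be the system with the $j$-th output (the $j$-th row of $C$ and $D$) removed, let $\mathcal R_j^\star$ be the subspace $\mathcal R^\star$ of $\Sigma_j$, and for $\mu\in\mathbb R$ let $\mathcal R_j^\star(\mu)$ be the set of all $v\in\mathbb R^n$ for which some $w\in\mathbb R^m$ satisfies $(A-\mu I)v+Bw=0$ and $C_{(j)}v+D_{(j)}w=0$. Assumptions. $\Sigma$ is right invertible (the transfer matrix $C(\lambda I-A)^{-1}B+D$ has a rational right inverse) and stabilisable ($A+BF$ is asymptotically stable for some real $F$); $\Sigma$ has no invariant zero at $0$ in continuous time, respectively at $1$ in discrete time; every invariant zero in $\mathbb C_g$ has algebraic multiplicity one; and $\dim\mathcal V_g^\star=n-p$.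 Problem 1 (global monotonicity) is solvable if for every admissible rate $\rho$ there is a matrix $F\in\mathbb R^{m\times n}$ such that $A+BF$ is asymptotically stable and the following holds. For every $r\in\mathbb R^p$, every $(x_{ss},u_{ss})$ with $Ax_{ss}+Bu_{ss}=0$ (respectively $=x_{ss}$) and $Cx_{ss}+Du_{ss}=r$, and every initial state $x(0)$, the tracking error $\epsilon=y-r$ under the control law $u(t)=F(x(t)-x_{ss})+u_{ss}$ has, for each component $\epsilon_k$, a constant $\beta_k\in\mathbb R$ with $|\epsilon_k(t)|\le\beta_k e^{\rho t}$ (respectively $|\epsilon_k(t)|\le\beta_k\rho^t$) for all $t$, and each $\epsilon_k$ is strictly monotonic in $t$ or identically zero. Under these assumptions, Problem 1 is solvable if and only if $$\dim\Big(\mathcal V_g^\star+\sum_{j\in S}\mathcal R_j^\star\Big)\ \ge\ n-p+\operatorname{card}(S)\qquad\text{for all }S\subseteq\{1,\dots,p\}.\tag{1}$$ Moreover, if (1) holds, the set of all $(\lambda_1,\dots,\lambda_p)\in\mathbb R^p$ such that each $\lambda_i$ is an admissible rate and not an invariant zero of $\Sigma$, and for which $$\dim\Big(\mathcal V_g^\star+\sum_{j\in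 S}\mathcal R_j^\star(\lambda_j)\Big)\ \ge\ n-p+\operatorname{card}(S)\qquad\text{for all }S\subseteq\{1,\dots,p\}$$ fails, has empty interior in $\mathbb R^p$. -/

import Mathlib

open Matrix

/-- The two kinds of time set: `ℝ⁺` (differential equations) and `ℕ` (difference equations). -/
inductive TimeDomain
  | continuous
  | discrete

namespace TimeDomain

/-- The stability region `ℂ_g`: the open left half-plane, respectively the open unit disc. -/
def stableRegion : TimeDomain → Set ℂ
  | continuous => {z | z.re < 0}
  | discrete => {z | ‖z‖ < 1}

/-- The frequency of constant signals: `0` in continuous time, `1` in discrete time. -/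
def constantFrequency : TimeDomain → ℂ
  | continuous => 0
  | discrete => 1

/-- The admissible convergence rates: `ρ < 0`, respectively `0 < ρ < 1`. -/
def IsRate : TimeDomain → ℝ → Prop
  | continuous, ρ => ρ < 0
  | discrete, ρ => 0 < ρ ∧ ρ < 1

end TimeDomain

/-- A finite-dimensional real linear time-invariant system `(A, B, C, D)` with state space `ℝⁿ`,
input space `ℝᵐ` and outputs labelled by `κ`. -/
structure LTISystem (n m : ℕ) (κ : Type) where
  A : Matrix (Fin n) (Fin n) ℝ
  B : Matrix (Fin n) (Fin m) ℝ
  C : Matrix κ (Fin n) ℝ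
  D : Matrix κ (Fin m) ℝ

namespace LTISystem

noncomputable section

variable {n m : ℕ} {κ : Type}

/-- The system in which the `j`-th output is removed. -/
def removeOutput (S : LTISystem n m κ) (j : κ) : LTISystem n m {i : κ // i ≠ j} where
  A := S.A
  B := S.B
  C := S.C.submatrix Subtype.val id
  D := S.D.submatrix Subtype.val id

/-- The closed-loop state matrix `A + B F`. -/
def closedA (S : LTISystem n m κ) (F : Matrix (Fin m) (Fin n) ℝ) : Matrix (Fin n) (Fin n) ℝ :=
  S.A + S.B * F

/-- The closed-loop output matrix `C + D F`. -/
def closedC (S : LTISystem n m κ) (F : Matrix (Fin m) (Fin n) ℝ) : Matrix κ (Fin n) ℝ :=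
  S.C + S.D * F

/-! ### Transfer matrix, Rosenbrock pencil, invariant zeros -/

/-- The transfer matrix `C (λ I - A)⁻¹ B + D`, a matrix of rational functions. -/
def transferMatrix (S : LTISystem n m κ) : Matrix κ (Fin m) (RatFunc ℝ) :=
  S.C.map RatFunc.C * ((RatFunc.X : RatFunc ℝ) • (1 : Matrix (Fin n) (Fin n) (RatFunc ℝ))
      - S.A.map RatFunc.C)⁻¹ * S.B.map RatFunc.C + S.D.map RatFunc.C

/-- Right invertibility: the transfer matrix has a right inverse over the rational functions. -/
def RightInvertible [DecidableEq κ] (S : LTISystem n m κ) : Prop :=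
  ∃ L : Matrix (Fin m) κ (RatFunc ℝ), S.transferMatrix * L = 1

/-- The Rosenbrock system matrix `[A - z I, B; C, D]` at `z ∈ ℂ`. -/
def rosenbrock (S : LTISystem n m κ) (z : ℂ) : Matrix (Fin n ⊕ κ) (Fin n ⊕ Fin m) ℂ :=
  Matrix.fromBlocks (S.A.map Complex.ofReal - z • (1 : Matrix (Fin n) (Fin n) ℂ))
    (S.B.map Complex.ofReal) (S.C.map Complex.ofReal) (S.D.map Complex.ofReal)

/-- The normal rank of the Rosenbrock pencil: the maximum over `z ∈ ℂ` of its rank at `z`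
(the ranks are bounded by the number `n + m` of columns). -/
def normalRank (S : LTISystem n m κ) : ℕ :=
  ⨆ z : ℂ, (S.rosenbrock z).rank

/-- Invariant zeros: the points where the Rosenbrock matrix loses rank. -/
def IsInvariantZero (S : LTISystem n m κ) (z : ℂ) : Prop :=
  (S.rosenbrock z).rank < S.normalRank

/-- The Rosenbrock pencil as a matrix of polynomials. -/
def rosenbrockPoly (S : LTISystem n m κ) :
    Matrix (Fin n ⊕ κ) (Fin n ⊕ Fin m) (Polynomial ℂ) :=
  Matrix.fromBlocks
    (S.A.map (fun a => Polynomial.C (a : ℂ))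
      - (Polynomial.X : Polynomial ℂ) • (1 : Matrix (Fin n) (Fin n) (Polynomial ℂ)))
    (S.B.map (fun a => Polynomial.C (a : ℂ)))
    (S.C.map (fun a => Polynomial.C (a : ℂ)))
    (S.D.map (fun a => Polynomial.C (a : ℂ)))

/-- The algebraic multiplicity of `z` as an invariant zero: the multiplicity of `z` as a root of the
product of the invariant polynomials (nonzero diagonal entries of the Smith form) of the pencil.
With `r` the normal rank, this product is the greatest common divisor of the nonzero minors of
order `r`, so its root multiplicity at `z` is the least root multiplicity among these minors. -/
def zeroMultiplicity (S : LTISystem n m κ) (z : ℂ) : ℕ :=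
  sInf {k : ℕ | ∃ (row : Fin S.normalRank → Fin n ⊕ κ) (col : Fin S.normalRank → Fin n ⊕ Fin m),
    (S.rosenbrockPoly.submatrix row col).det ≠ 0 ∧
      Polynomial.rootMultiplicity z (S.rosenbrockPoly.submatrix row col).det = k}

/-! ### Stability -/

/-- A real square matrix is asymptotically stable if all its complex eigenvalues are in `ℂ_g`. -/
def AsymptoticallyStable (τ : TimeDomain) (M : Matrix (Fin n) (Fin n) ℝ) : Prop :=
  M.charpoly.rootSet ℂ ⊆ τ.stableRegion

/-- Stabilisability of the pair `(A, B)`. -/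
def Stabilisable (τ : TimeDomain) (S : LTISystem n m κ) : Prop :=
  ∃ F : Matrix (Fin m) (Fin n) ℝ, AsymptoticallyStable τ (S.closedA F)

/-! ### Output-nulling subspaces -/

/-- `F` is a friend of `V`: `(A + B F) V ⊆ V ⊆ ker (C + D F)`. -/
def IsFriend (S : LTISystem n m κ) (V : Submodule ℝ (Fin n → ℝ))
    (F : Matrix (Fin m) (Fin n) ℝ) : Prop :=
  (∀ v ∈ V, (S.closedA F).mulVecLin v ∈ V) ∧ V ≤ LinearMap.ker (S.closedC F).mulVecLin

/-- `V*`, the largest output-nulling subspace: the supremum of all subspaces with a friend. -/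
def Vstar (S : LTISystem n m κ) : Submodule ℝ (Fin n → ℝ) :=
  sSup {V | ∃ F, S.IsFriend V F}

/-- `V*_g`, the largest stabilisability output-nulling subspace: the supremum of all subspaces `V`
with a friend `F` such that the eigenvalues of `A + B F` restricted to `V` are in `ℂ_g`. -/
def VstarG (τ : TimeDomain) (S : LTISystem n m κ) : Submodule ℝ (Fin n → ℝ) :=
  sSup {V | ∃ (F : Matrix (Fin m) (Fin n) ℝ) (h : S.IsFriend V F),
    ((S.closedA F).mulVecLin.restrict h.1).charpoly.rootSet ℂ ⊆ τ.stableRegion}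

/-- `R*`, the output-nulling reachability subspace: the smallest `(A + B F)`-invariant subspace
that contains `V* ∩ B ker D`, where `F` is a friend of `V*`. (This subspace is the same for
every friend `F`.) -/
def Rstar (S : LTISystem n m κ) : Submodule ℝ (Fin n → ℝ) :=
  sInf {W | S.Vstar ⊓ (LinearMap.ker S.D.mulVecLin).map S.B.mulVecLin ≤ W ∧
    ∃ F, S.IsFriend S.Vstar F ∧ ∀ v ∈ W, (S.closedA F).mulVecLin v ∈ W}

/-- `R*(μ)`, the projection on the state space of the kernel of the Rosenbrock matrix at the real
number `μ`. -/
def RstarAt (S : LTISystem n m κ) (μ : ℝ) : Submodule ℝ (Fin n → ℝ) where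
  carrier := {v | ∃ w : Fin m → ℝ,
    (S.A - μ • (1 : Matrix (Fin n) (Fin n) ℝ)) *ᵥ v + S.B *ᵥ w = 0 ∧ S.C *ᵥ v + S.D *ᵥ w = 0}
  zero_mem' := ⟨0, by simp⟩
  add_mem' := by
    rintro a b ⟨w, h₁, h₂⟩ ⟨w', h₁', h₂'⟩
    refine ⟨w + w', ?_, ?_⟩
    · rw [mulVec_add, mulVec_add, add_add_add_comm, h₁, h₁', add_zero]
    · rw [mulVec_add, mulVec_add, add_add_add_comm, h₂, h₂', add_zero]
  smul_mem' := by
    rintro c a ⟨w, h₁, h₂⟩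
    refine ⟨c • w, ?_, ?_⟩
    · rw [mulVec_smul, mulVec_smul, ← smul_add, h₁, smul_zero]
    · rw [mulVec_smul, mulVec_smul, ← smul_add, h₂, smul_zero]

/-! ### The tracking problem -/

/-- `(xss, uss)` is an equilibrium with output `r`. -/
def IsSteadyState : TimeDomain → (S : LTISystem n m κ) → (Fin n → ℝ) → (Fin m → ℝ) → (κ → ℝ) → Prop
  | .continuous, S, xss, uss, r => 0 = S.A *ᵥ xss + S.B *ᵥ uss ∧ r = S.C *ᵥ xss + S.D *ᵥ uss
  | .discrete, S, xss, uss, r => xss = S.A *ᵥ xss + S.B *ᵥ uss ∧ r = S.C *ᵥ xss + S.D *ᵥ uss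

/-- The control law `u = F (x - xss) + uss`. -/
def trackingInput (F : Matrix (Fin m) (Fin n) ℝ) (xss : Fin n → ℝ) (uss : Fin m → ℝ)
    (x : Fin n → ℝ) : Fin m → ℝ :=
  F *ᵥ (x - xss) + uss

/-- The tracking error `ε = y - r` in the state `x`, where `y = C x + D u` and `u` is given by the
control law. -/
def trackingError (S : LTISystem n m κ) (F : Matrix (Fin m) (Fin n) ℝ) (xss : Fin n → ℝ)
    (uss : Fin m → ℝ) (r : κ → ℝ) (x : Fin n → ℝ) : κ → ℝ :=
  S.C *ᵥ x + S.D *ᵥ trackingInput F xss uss x - r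

/-- The real signal `e` on `[0, ∞)` is identically zero, or strictly monotonic. -/
def StrictlyMonotonicOrZeroCont (e : ℝ → ℝ) : Prop :=
  (∀ t, 0 ≤ t → e t = 0) ∨ StrictMonoOn e (Set.Ici 0) ∨ StrictAntiOn e (Set.Ici 0)

/-- The real sequence `e` is identically zero, or strictly monotonic. -/
def StrictlyMonotonicOrZeroDisc (e : ℕ → ℝ) : Prop :=
  (∀ t, e t = 0) ∨ StrictMono e ∨ StrictAnti e

/-- `F` solves the problem of global monotonicity with rate `ρ`: the closed loop is asymptotically
stable, and for every reference `r`, every equilibrium with output `r`, and every trajectory of the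
closed loop (hence every initial state), each component of the tracking error is bounded by a
multiple of `exp (ρ t)` (respectively `ρ ^ t`) and is strictly monotonic or identically zero. -/
def SolvesGlobalMonotonicity :
    TimeDomain → (S : LTISystem n m κ) → ℝ → Matrix (Fin m) (Fin n) ℝ → Prop
  | .continuous, S, ρ, F =>
    AsymptoticallyStable .continuous (S.closedA F) ∧
    ∀ (r : κ → ℝ) (xss : Fin n → ℝ) (uss : Fin m → ℝ), IsSteadyState .continuous S xss uss r →
      ∀ x : ℝ → Fin n → ℝ,
        (∀ t, 0 ≤ t → HasDerivWithinAt x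
          (S.A *ᵥ x t + S.B *ᵥ trackingInput F xss uss (x t)) (Set.Ici 0) t) →
        ∀ k : κ,
          (∃ β : ℝ, ∀ t, 0 ≤ t →
            |S.trackingError F xss uss r (x t) k| ≤ β * Real.exp (ρ * t)) ∧
          StrictlyMonotonicOrZeroCont (fun t => S.trackingError F xss uss r (x t) k)
  | .discrete, S, ρ, F =>
    AsymptoticallyStable .discrete (S.closedA F) ∧
    ∀ (r : κ → ℝ) (xss : Fin n → ℝ) (uss : Fin m → ℝ), IsSteadyState .discrete S xss uss r →
      ∀ x : ℕ → Fin n → ℝ,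
        (∀ t, x (t + 1) = S.A *ᵥ x t + S.B *ᵥ trackingInput F xss uss (x t)) →
        ∀ k : κ,
          (∃ β : ℝ, ∀ t, |S.trackingError F xss uss r (x t) k| ≤ β * ρ ^ t) ∧
          StrictlyMonotonicOrZeroDisc (fun t => S.trackingError F xss uss r (x t) k)

/-- The problem of global monotonicity is solvable: at every admissible rate `ρ` there is a feedback
matrix that solves it. -/
def GlobalMonotonicitySolvable (τ : TimeDomain) (S : LTISystem n m κ) : Prop :=
  ∀ ρ : ℝ, τ.IsRate ρ → ∃ F : Matrix (Fin m) (Fin n) ℝ, SolvesGlobalMonotonicity τ S ρ F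

/-! ### The two families of dimension conditions -/

/-- For every set `T` of outputs, `dim (V*_g + ∑_{j ∈ T} R*_j) ≥ n - p + card T`. -/
def StructuralCondition {p : ℕ} (τ : TimeDomain) (S : LTISystem n m (Fin p)) : Prop :=
  ∀ T : Finset (Fin p), (n : ℤ) - p + T.card ≤
    Module.finrank ℝ ↥(S.VstarG τ ⊔ ⨆ j ∈ T, (S.removeOutput j).Rstar)

/-- For every set `T` of outputs, `dim (V*_g + ∑_{j ∈ T} R*_j(λ_j)) ≥ n - p + card T`. -/
def FixedEigenvalueCondition {p : ℕ} (τ : TimeDomain) (S : LTISystem n m (Fin p))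
    (lam : Fin p → ℝ) : Prop :=
  ∀ T : Finset (Fin p), (n : ℤ) - p + T.card ≤
    Module.finrank ℝ ↥(S.VstarG τ ⊔ ⨆ j ∈ T, (S.removeOutput j).RstarAt (lam j))

/-- The tuples `(λ₁, …, λ_p)` of admissible real rates that are not invariant zeros. -/
def admissibleTuples {p : ℕ} (τ : TimeDomain) (S : LTISystem n m (Fin p)) : Set (Fin p → ℝ) :=
  {lam | ∀ i, τ.IsRate (lam i) ∧ ¬ S.IsInvariantZero (lam i : ℂ)}

end

end LTISystem

/-! Monotonicity from every initial state forces each error component to be a single mode. An error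
that agrees at times 0 and 1 must vanish identically. So, with `φ` the output functional and `f` the
closed loop, `φ` and `φ ∘ f` vanish on the kernel of the functional comparing these two times; both
are multiples of it, and `φ ∘ f = μ φ`. Conversely, such outputs are multiples of `exp (μ t)` or `μ
^ t`. The problem thus becomes algebraic (`solvesGlobalMonotonicity_iff`).

Sufficiency: `V*_g` has codimension `p`, so it is enough to find `x_j` in `R*_j(λ_j)` independent
modulo `V*_g`; a feedback then stabilises `V*_g` and makes each `x_j` an eigenvector seen by output
`j` at most. Rado's theorem in the quotient by `V*_g` gives independent vectors from the `R*_j`. As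
`R*_j` is spanned by the `R*_j(μ)` with `μ` in any infinite set, an exchange argument moves them
into single `R*_j(λ_j)`. Freedom in the infinite sets yields both arbitrarily fast rates and the
empty interior.

Necessity: by dimension, `ker (C + D F)` is `V*_g`, and the vectors `x_k` dual to the outputs are
eigenvectors modulo `V*_g`. Relative to a friend `F'_k` fixed in advance for the system without
output `k`, `A + B F'_k - μ_k` sends `x_k` into `V*_g + R*_k`. For `ρ` low enough `μ_k` is not an
eigenvalue of `A + B F'_k`, and inverting on this invariant subspace puts `x_k` inside it. Counting
dimensions finishes. -/

/-! ### Linear algebra: preimages under shifts, transversals, exchange -/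

open Polynomial in
/-- Any subspace is contained in the span of its preimages under `f - μ`, where `μ` ranges over an
infinite set. -/
theorem Submodule.le_iSup_comap_sub_smul {K E : Type*} [Field K] [AddCommGroup E] [Module K E]
    [FiniteDimensional K E] (f : Module.End K E) (U : Submodule K E) {L : Set K}
    (hL : L.Infinite) :
    U ≤ ⨆ μ ∈ L, U.comap (f - μ • (1 : Module.End K E)) := by
  classical
  have hfin : Set.Finite {μ : K | f.HasEigenvalue μ} := Module.End.finite_hasEigenvalue f
  -- As many nodes as the dimension, so that the nodal and characteristic polynomials are monic of
  -- equal degree; no node is an eigenvalue, so that the nodal polynomial of `f` is invertible.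
  obtain ⟨s, hsL, hcard⟩ := (hL.sdiff hfin).exists_subset_card_eq (Module.finrank K E)
  have haev (μ : K) : aeval f (X - C μ) = f - μ • (1 : Module.End K E) := by
    simp [Algebra.algebraMap_eq_smul_one]
  have hunit : IsUnit (aeval f (Lagrange.nodal s id)) := by
    rw [Lagrange.nodal_eq]
    refine Finset.prod_induction _ (fun g => IsUnit (aeval f g)) ?_ (by simp) ?_
    · intro a b ha hb
      rw [map_mul]
      exact ha.mul hb
    · intro μ hμ
      have h := (hsL hμ).2
      rw [Set.mem_ofPred_eq, Module.End.hasEigenvalue_iff_mem_spectrum, spectrum.mem_iff,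
        not_not] at h
      simpa using h.neg
  have hdeg : (Lagrange.nodal s id - f.charpoly).degree < s.card := by
    rw [← Lagrange.degree_nodal (R := K) (s := s) (v := id)]
    refine degree_sub_lt_left ?_ Lagrange.nodal_ne_zero ?_
    · rw [Lagrange.degree_nodal, degree_eq_natDegree f.charpoly_monic.ne_zero,
        f.charpoly_natDegree, hcard]
    · rw [Lagrange.nodal_monic.leadingCoeff, f.charpoly_monic.leadingCoeff]
  -- By Cayley–Hamilton the difference has the same value at `f` as the nodal polynomial, which is
  -- thereby a combination of Lagrange basis polynomials of `f`.
  have hint := Lagrange.eq_interpolate (v := id) (Set.injOn_id _) hdeg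
  rw [Lagrange.interpolate_apply] at hint
  have hq := congrArg (aeval f) hint
  rw [map_sub, LinearMap.aeval_self_charpoly, sub_zero, map_sum] at hq
  intro u hu
  -- With `u = nodal(f) v`, the expansion splits `u` into one term per node `μ`; applying `f - μ`
  -- completes that term's basis polynomial to a multiple of the nodal one, so the result is a
  -- multiple of `u`.
  obtain ⟨v, hv⟩ := ((Module.End.isUnit_iff _).1 hunit).2 u
  rw [← hv, hq, LinearMap.sum_apply]
  refine Submodule.sum_mem _ fun μ hμ => ?_
  refine Submodule.mem_iSup_of_mem μ (Submodule.mem_iSup_of_mem (hsL hμ).1 ?_)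
  rw [Submodule.mem_comap, ← haev, ← Module.End.mul_apply, ← map_mul, mul_left_comm,
    Lagrange.basis_eq_prod_sub_inv_mul_nodal_div hμ, mul_left_comm (X - C μ),
    ← Lagrange.nodal_erase_eq_nodal_div hμ]
  have h2 := Lagrange.nodal_eq_mul_nodal_erase (v := (id : K → K)) hμ
  rw [id] at h2
  rw [← h2, ← mul_assoc, ← C_mul, ← smul_eq_C_mul, map_smul, LinearMap.smul_apply, hv]
  exact U.smul_mem _ hu

/-- Rado's theorem for subspaces. -/
theorem exists_linearIndependent_transversal {K Y ι : Type*} [Field K] [AddCommGroup Y]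
    [Module K Y] [FiniteDimensional K Y] [Fintype ι] [DecidableEq ι] (M : ι → Submodule K Y)
    (hM : ∀ T : Finset ι, T.card ≤ Module.finrank K ↥(⨆ j ∈ T, M j)) :
    ∃ y : ι → Y, (∀ j, y j ∈ M j) ∧ LinearIndependent K y := by
  -- Induction on the total dimension: the subspaces are shrunk until each is at most a line, where
  -- the condition for the full index set gives independence.
  induction hN : ∑ j, Module.finrank K (M j) using Nat.strong_induction_on generalizing M with
  | _ N ih =>
  subst hN
  by_cases hone : ∀ j, Module.finrank K (M j) ≤ 1
  · have hspan : ∀ j, ∃ v, M j = Submodule.span K {v} := fun j =>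
      ((Submodule.finrank_le_one_iff_isPrincipal (M j)).1 (hone j)).principal
    choose y hy using hspan
    refine ⟨y, fun j => hy j ▸ Submodule.mem_span_singleton_self _, ?_⟩
    rw [linearIndependent_iff_card_le_finrank_span, Set.finrank]
    have h := hM Finset.univ
    rw [Finset.card_univ] at h
    refine h.trans_eq ?_
    have hsup : ⨆ j ∈ Finset.univ, M j = Submodule.span K (Set.range y) := by
      rw [Submodule.span_range_eq_iSup]
      simp [← hy]
    rw [hsup]
  · push Not at hone
    obtain ⟨i, hi⟩ := hone
    have hex : ∃ H H' : Submodule K Y, H ⊔ H' = M i ∧ H < M i ∧ H' < M i := by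
      have : (M i) ≠ ⊥ := by
        rintro h
        rw [h, finrank_bot] at hi
        omega
      obtain ⟨v, hv, hv0⟩ := Submodule.exists_mem_ne_zero_of_ne_bot this
      obtain ⟨W, hW⟩ := Submodule.exists_isCompl (Submodule.span K {v})
      have hle : Submodule.span K {v} ≤ M i := by simpa using hv
      refine ⟨Submodule.span K {v}, W ⊓ M i, ?_, ?_, ?_⟩
      · rw [← sup_inf_assoc_of_le W hle, hW.sup_eq_top, top_inf_eq]
      · refine lt_of_le_of_ne hle fun h => ?_
        rw [← h, finrank_span_singleton hv0] at hi
        omega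
      · refine lt_of_le_of_ne inf_le_right fun h => hv0 ?_
        have h1 : v ∈ W := (h.ge hv).1
        exact Submodule.disjoint_def.1 hW.disjoint v (Submodule.mem_span_singleton_self v) h1
    -- If `H` cannot replace `M i`, some violating set exists. It contains `i`, since the others are
    -- unaffected; deleting `i` turns the strict inequality into `≤ T.card`.
    have key : ∀ H < M i, (∃ y : ι → Y, (∀ j, y j ∈ M j) ∧ LinearIndependent K y) ∨
        ∃ T : Finset ι, i ∉ T ∧ Module.finrank K ↥(H ⊔ ⨆ j ∈ T, M j) ≤ T.card := by
      intro H hH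
      have hupd : ∀ T : Finset ι, i ∉ T →
          (⨆ j ∈ T, Function.update M i H j) = ⨆ j ∈ T, M j := fun T hiT =>
        iSup_congr fun j => iSup_congr fun hj => by
          rw [Function.update_of_ne]
          rintro rfl
          exact hiT hj
      by_cases hc : ∀ T : Finset ι,
          T.card ≤ Module.finrank K ↥(⨆ j ∈ T, Function.update M i H j)
      · left
        have hle : ∀ j, Function.update M i H j ≤ M j := fun j => by
          rcases eq_or_ne j i with rfl | hj
          · simpa using hH.le
          · simp [hj]
        obtain ⟨y, hy, hind⟩ := ih _ (Finset.sum_lt_sum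
          (fun j _ => Submodule.finrank_mono (hle j))
          ⟨i, Finset.mem_univ i, by
            rw [Function.update_self]
            exact Submodule.finrank_lt_finrank_of_lt hH⟩) _ hc rfl
        exact ⟨y, fun j => hle j (hy j), hind⟩
      · right
        push Not at hc
        obtain ⟨T, hT⟩ := hc
        by_cases hiT : i ∈ T
        · refine ⟨T.erase i, Finset.notMem_erase i T, ?_⟩
          rw [← Finset.insert_erase hiT,
            Finset.iSup_insert, Function.update_self, hupd _ (Finset.notMem_erase i T),
            Finset.card_insert_of_notMem (Finset.notMem_erase i T)] at hT
          omega
        · exfalso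
          rw [hupd T hiT] at hT
          exact absurd (hM T) (by omega)
    obtain ⟨H, H', hsup, hH, hH'⟩ := hex
    rcases key H hH with h | ⟨T, hiT, hT⟩
    · exact h
    rcases key H' hH' with h | ⟨T', hiT', hT'⟩
    · exact h
    exfalso
    -- Submodularity: the two tight sets bound the sum of the dimensions by `T.card + T'.card`,
    -- while the hypothesis on `insert i (T ∪ T')` and `T ∩ T'` demands one more.
    have h1 := Submodule.finrank_sup_add_finrank_inf_eq (H ⊔ ⨆ j ∈ T, M j) (H' ⊔ ⨆ j ∈ T', M j)
    have h2 : (H ⊔ ⨆ j ∈ T, M j) ⊔ (H' ⊔ ⨆ j ∈ T', M j) = ⨆ j ∈ insert i (T ∪ T'), M j := by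
      rw [sup_sup_sup_comm, hsup, Finset.iSup_insert, Finset.iSup_union]
    have h3 := hM (insert i (T ∪ T'))
    have h4 := (hM (T ∩ T')).trans (Submodule.finrank_mono (t := (H ⊔ ⨆ j ∈ T, M j) ⊓ (H' ⊔ ⨆ j ∈ T', M j))
      (iSup₂_le fun j hj => le_inf
        (le_sup_of_le_right (le_iSup₂_of_le j (Finset.mem_inter.1 hj).1 le_rfl))
        (le_sup_of_le_right (le_iSup₂_of_le j (Finset.mem_inter.1 hj).2 le_rfl))))
    rw [h2] at h1
    rw [Finset.card_insert_of_notMem (by simp [hiT, hiT'])] at h3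
    have h5 := Finset.card_union_add_card_inter T T'
    omega

/-- The vectors of a basis can be replaced, one after the other, by elements of sets in whose spans
they lie. -/
theorem LinearIndependent.exists_mem_of_mem_span {K Y ι : Type*} [Field K] [AddCommGroup Y]
    [Module K Y] [FiniteDimensional K Y] [Fintype ι] [DecidableEq ι] {y : ι → Y}
    (hy : LinearIndependent K y) (hcard : Fintype.card ι = Module.finrank K Y)
    (G : ι → Set Y) (hG : ∀ i, y i ∈ Submodule.span K (G i)) :
    ∃ z : ι → Y, (∀ i, z i ∈ G i) ∧ LinearIndependent K z := by
  have main : ∀ s : Finset ι, ∃ z : ι → Y, (∀ i ∈ s, z i ∈ G i) ∧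
      (∀ i ∉ s, z i = y i) ∧ LinearIndependent K z := by
    intro s
    induction s using Finset.induction_on with
    | empty => exact ⟨y, by simp, by simp, hy⟩
    | insert i s his ih =>
      obtain ⟨z, hz, hzy, hind⟩ := ih
      cases isEmpty_or_nonempty ι
      · exact (IsEmpty.false i).elim
      let b := basisOfLinearIndependentOfCardEqFinrank hind hcard
      have hb : ∀ j, b j = z j := fun j => by simp [b]
      -- Otherwise the whole span of `G i` would have zero `i`-th coordinate, but `y i = z i` has
      -- coordinate 1.
      have hex : ∃ g ∈ G i, b.repr g i ≠ 0 := by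
        by_contra! hcon
        have hle : Submodule.span K (G i) ≤ LinearMap.ker (b.coord i) :=
          Submodule.span_le.2 fun g hg => by simpa using hcon g hg
        have h0 := hle (hG i)
        rw [← hzy i his, ← hb i] at h0
        simp at h0
      obtain ⟨g, hg, hgi⟩ := hex
      refine ⟨Function.update z i g, ?_, ?_, ?_⟩
      · intro j hj
        rcases eq_or_ne j i with rfl | hne
        · simpa using hg
        · rw [Function.update_of_ne hne]
          exact hz j (Finset.mem_of_mem_insert_of_ne hj hne)
      · intro j hj
        rw [Finset.mem_insert, not_or] at hj
        rw [Function.update_of_ne hj.1]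
        exact hzy j hj.2
      · refine hind.update i g ⟨1, one_mem _, b.repr g, by simpa using hgi, ?_⟩
        rw [one_smul]
        conv_lhs => rw [← b.linearCombination_repr g]
        congr 2
        ext j
        exact hb j
  obtain ⟨z, hz, -, hind⟩ := main Finset.univ
  exact ⟨z, fun i => hz i (Finset.mem_univ i), hind⟩

/-- Rank-nullity for a subspace that contains the kernel. -/
theorem Submodule.finrank_map_add_finrank_ker_of_le {K X Y : Type*} [Field K] [AddCommGroup X]
    [Module K X] [AddCommGroup Y] [Module K Y] [FiniteDimensional K X] (g : X →ₗ[K] Y)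
    {N : Submodule K X} (h : LinearMap.ker g ≤ N) :
    Module.finrank K (N.map g) + Module.finrank K (LinearMap.ker g) = Module.finrank K N := by
  have h1 := LinearMap.finrank_range_add_finrank_ker (g.domRestrict N)
  rw [LinearMap.range_domRestrict, LinearMap.ker_domRestrict] at h1
  rw [← h1, (Submodule.comapSubtypeEquivOfLe h).finrank_eq]

/-! ### Spectral regions through annihilating polynomials -/

open Polynomial in
/-- All complex roots of the real polynomial `q` lie in `G`. -/
def Polynomial.RootsIn (G : Set ℂ) (q : ℝ[X]) : Prop :=
  ∀ z : ℂ, aeval z q = 0 → z ∈ G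

namespace Module.End

open Polynomial

variable {X : Type*} [AddCommGroup X] [Module ℝ X]

theorem aeval_apply_mem {W : Submodule ℝ X} {f : Module.End ℝ X} (hW : ∀ v ∈ W, f v ∈ W)
    (q : ℝ[X]) {v : X} (hv : v ∈ W) : aeval f q v ∈ W := by
  have hpow : ∀ k : ℕ, (f ^ k) v ∈ W := fun k => by
    induction k with
    | zero => simpa using hv
    | succ k ih => rw [pow_succ', Module.End.mul_apply]; exact hW _ ih
  rw [aeval_endomorphism]
  exact W.sum_mem fun k _ => W.smul_mem _ (hpow k)

/-- Two endomorphisms that agree on `V` modulo `W` have polynomials that agree on `V` modulo `W`. -/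
theorem aeval_apply_sub_mem {V W : Submodule ℝ X} {f g : Module.End ℝ X}
    (hV : ∀ v ∈ V, g v ∈ V) (hW : ∀ v ∈ W, f v ∈ W) (h : ∀ v ∈ V, f v - g v ∈ W)
    (q : ℝ[X]) {v : X} (hv : v ∈ V) : aeval f q v - aeval g q v ∈ W := by
  have hpow : ∀ k : ℕ, (g ^ k) v ∈ V ∧ (f ^ k) v - (g ^ k) v ∈ W := fun k => by
    induction k with
    | zero => simpa using hv
    | succ k ih =>
      simp only [pow_succ', Module.End.mul_apply]
      refine ⟨hV _ ih.1, ?_⟩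
      have := W.add_mem (hW _ ih.2) (h _ ih.1)
      rwa [map_sub, sub_add_sub_cancel] at this
  simp only [aeval_endomorphism, Polynomial.sum_def]
  rw [← Finset.sum_sub_distrib]
  refine W.sum_mem fun k _ => ?_
  rw [← smul_sub]
  exact W.smul_mem _ (hpow k).2

/-- The vectors that are mapped into the invariant subspace `W` by some polynomial in `f` with all
roots in `G`. -/
def torsionIn (G : Set ℂ) (f : Module.End ℝ X) (W : Submodule ℝ X) (hW : ∀ v ∈ W, f v ∈ W) :
    Submodule ℝ X where
  carrier := {v | ∃ q : ℝ[X], q.RootsIn G ∧ aeval f q v ∈ W}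
  zero_mem' := ⟨1, fun z hz => by simp at hz, by simp⟩
  add_mem' := by
    rintro a b ⟨q, hq, ha⟩ ⟨r, hr, hb⟩
    refine ⟨q * r, fun z hz => ?_, ?_⟩
    · rw [map_mul, mul_eq_zero] at hz
      exact hz.elim (hq z) (hr z)
    · rw [map_add]
      refine W.add_mem ?_ ?_
      · rw [mul_comm, map_mul, Module.End.mul_apply]
        exact aeval_apply_mem hW r ha
      · rw [map_mul, Module.End.mul_apply]
        exact aeval_apply_mem hW q hb
  smul_mem' := by
    rintro c a ⟨q, hq, ha⟩
    exact ⟨q, hq, by rw [map_smul]; exact W.smul_mem _ ha⟩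

theorem mem_torsionIn {G : Set ℂ} {f : Module.End ℝ X} {W : Submodule ℝ X}
    {hW : ∀ v ∈ W, f v ∈ W} {v : X} :
    v ∈ torsionIn G f W hW ↔ ∃ q : ℝ[X], q.RootsIn G ∧ aeval f q v ∈ W := Iff.rfl

/-- The vectors annihilated by some polynomial in `f` with all roots in `G`. -/
abbrev torsionAt (G : Set ℂ) (f : Module.End ℝ X) : Submodule ℝ X :=
  torsionIn G f ⊥ (by simp)

theorem mem_torsionAt {G : Set ℂ} {f : Module.End ℝ X} {v : X} :
    v ∈ torsionAt G f ↔ ∃ q : ℝ[X], q.RootsIn G ∧ aeval f q v = 0 := by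
  simp [mem_torsionIn]

theorem mem_torsionAt_of_aeval_mem {G : Set ℂ} {f : Module.End ℝ X} {q : ℝ[X]} {v : X}
    (hq : q.RootsIn G) (h : aeval f q v ∈ torsionAt G f) : v ∈ torsionAt G f := by
  obtain ⟨r, hr, h0⟩ := mem_torsionAt.1 h
  refine mem_torsionAt.2 ⟨r * q, fun z hz => ?_, by rw [map_mul, Module.End.mul_apply, h0]⟩
  rw [map_mul, mul_eq_zero] at hz
  exact hz.elim (hr z) (hq z)

/-- Cayley–Hamilton gives one direction. For the other, annihilators of the basis vectors multiply
to a polynomial killing `f`, which must vanish at every complex eigenvalue. In the torsion form,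
stability can be checked vector by vector. -/
theorem rootSet_charpoly_subset_iff [FiniteDimensional ℝ X] {G : Set ℂ} {f : Module.End ℝ X} :
    f.charpoly.rootSet ℂ ⊆ G ↔ torsionAt G f = ⊤ := by
  constructor
  · intro h
    refine eq_top_iff.2 fun v _ => mem_torsionAt.2 ⟨f.charpoly, fun z hz => h ?_, by
      simp [LinearMap.aeval_self_charpoly]⟩
    exact (mem_rootSet_of_ne f.charpoly_monic.ne_zero).2 hz
  · intro h z hz
    let b := Module.finBasis ℝ X
    have hb : ∀ i, ∃ q : ℝ[X], q.RootsIn G ∧ aeval f q (b i) = 0 := fun i =>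
      mem_torsionAt.1 (h ▸ Submodule.mem_top)
    choose q hq h0 using hb
    have hann : aeval f (∏ i, q i) = 0 := b.ext fun i => by
      rw [← Finset.prod_erase_mul _ _ (Finset.mem_univ i), map_mul, Module.End.mul_apply, h0]
      simp
    have hroot : aeval z (∏ i, q i) = 0 := by
      have hz' : (f.baseChange ℂ).charpoly.IsRoot z := by
        rw [LinearMap.charpoly_baseChange, IsRoot.def, eval_map_algebraMap]
        exact (mem_rootSet_of_ne f.charpoly_monic.ne_zero).1 hz
      obtain ⟨w, hw⟩ := ((Module.End.hasEigenvalue_iff_isRoot_charpoly _ _).2 hz').exists_hasEigenvector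
      have h1 := Module.End.aeval_apply_of_hasEigenvector (p := (∏ i, q i).map (algebraMap ℝ ℂ)) hw
      have h2 : aeval (f.baseChange ℂ) (∏ i, q i) = 0 := by
        have := Polynomial.aeval_algHom_apply (Module.End.baseChangeHom ℝ ℂ X) f (∏ i, q i)
        rw [hann, map_zero] at this
        exact this
      rw [aeval_map_algebraMap, h2, LinearMap.zero_apply, eval_map_algebraMap] at h1
      exact (smul_eq_zero.1 h1.symm).resolve_right hw.2
    rw [map_prod, Finset.prod_eq_zero_iff] at hroot
    obtain ⟨i, -, hi⟩ := hroot
    exact hq i z hi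

theorem coe_aeval_restrict {f : Module.End ℝ X} {V : Submodule ℝ X} (h : ∀ v ∈ V, f v ∈ V)
    (q : ℝ[X]) (v : V) : (aeval (f.restrict h) q v : X) = aeval f q v := by
  simp only [aeval_endomorphism, Polynomial.sum_def, Submodule.coe_sum, Submodule.coe_smul]
  refine Finset.sum_congr rfl fun k _ => ?_
  rw [Module.End.pow_restrict k]
  rfl

theorem rootSet_charpoly_restrict_subset_iff [FiniteDimensional ℝ X] {G : Set ℂ}
    {f : Module.End ℝ X} {V : Submodule ℝ X} (h : ∀ v ∈ V, f v ∈ V) :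
    (f.restrict h).charpoly.rootSet ℂ ⊆ G ↔ V ≤ torsionAt G f := by
  rw [rootSet_charpoly_subset_iff, eq_top_iff]
  constructor
  · intro hV v hv
    obtain ⟨q, hq, h0⟩ := mem_torsionAt.1 (hV (Submodule.mem_top (x := ⟨v, hv⟩)))
    exact mem_torsionAt.2 ⟨q, hq, by rw [← coe_aeval_restrict h q ⟨v, hv⟩, h0]; rfl⟩
  · rintro hV ⟨v, hv⟩ -
    obtain ⟨q, hq, h0⟩ := mem_torsionAt.1 (hV hv)
    exact mem_torsionAt.2 ⟨q, hq, Subtype.ext (by rw [coe_aeval_restrict h, h0]; rfl)⟩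

end Module.End

/-! ### Reachable vectors as shifted preimages -/

section GeneralizedControllability

variable {K X : Type*} [Field K] [AddCommGroup X] [Module K X]

/-- The span of the vectors of `V` that are mapped into `U` by some `f - μ` with `μ ∈ L`. -/
def shiftedPreimages (f : Module.End K X) (V U : Submodule K X) (L : Set K) : Submodule K X :=
  ⨆ μ ∈ L, V ⊓ U.comap (f - μ • (1 : Module.End K X))

theorem shiftedPreimages_le (f : Module.End K X) (V U : Submodule K X) (L : Set K) :
    shiftedPreimages f V U L ≤ V :=
  iSup₂_le fun _ _ => inf_le_left

theorem le_shiftedPreimages [FiniteDimensional K X] {f : Module.End K X} {V U : Submodule K X}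
    {L : Set K} (hL : L.Infinite) (hU : U ≤ V) (hV : ∀ v ∈ V, f v ∈ V) :
    U ≤ shiftedPreimages f V U L := by
  intro u hu
  have h := Submodule.le_iSup_comap_sub_smul (f.restrict hV) (U.comap V.subtype) hL
    (x := ⟨u, hU hu⟩) hu
  have h2 := Submodule.mem_map_of_mem (f := V.subtype) h
  simp only [Submodule.map_iSup] at h2
  refine (iSup₂_mono fun μ _ => ?_ : _ ≤ shiftedPreimages f V U L) h2
  rintro _ ⟨v, hv, rfl⟩
  exact ⟨v.2, hv⟩

/-- If `f v - μ v` lies in `U`, then `f v` is `μ v` plus an element of `U`, and `U` lies in the span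
by `le_shiftedPreimages`. -/
theorem apply_mem_shiftedPreimages [FiniteDimensional K X] {f : Module.End K X}
    {V U : Submodule K X} {L : Set K} (hL : L.Infinite) (hU : U ≤ V) (hV : ∀ v ∈ V, f v ∈ V) :
    ∀ v ∈ shiftedPreimages f V U L, f v ∈ shiftedPreimages f V U L := by
  suffices h : shiftedPreimages f V U L ≤ (shiftedPreimages f V U L).comap f from h
  refine iSup₂_le fun μ hμ v hv => ?_
  have h1 : v ∈ shiftedPreimages f V U L :=
    Submodule.mem_iSup_of_mem μ (Submodule.mem_iSup_of_mem hμ hv)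
  have h2 := le_shiftedPreimages hL hU hV hv.2
  have h3 := Submodule.add_mem _ h2 (Submodule.smul_mem _ μ h1)
  simpa using h3

end GeneralizedControllability

/-! ### Admissible rates -/

namespace TimeDomain

theorem isRate_infinite_of_lt (τ : TimeDomain) {ρ : ℝ} (hρ : τ.IsRate ρ) :
    {μ : ℝ | τ.IsRate μ ∧ μ < ρ}.Infinite := by
  cases τ with
  | continuous =>
    refine (Set.Iio_infinite ρ).mono fun μ hμ => ⟨?_, hμ⟩
    exact lt_trans hμ hρ
  | discrete =>
    refine (Set.Ioo_infinite hρ.1).mono fun μ hμ => ⟨⟨hμ.1, hμ.2.trans hρ.2⟩, hμ.2⟩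

theorem exists_isRate (τ : TimeDomain) : ∃ ρ, τ.IsRate ρ := by
  cases τ with
  | continuous => exact ⟨-1, by norm_num [IsRate]⟩
  | discrete => exact ⟨1 / 2, by norm_num [IsRate]⟩

/-- Some admissible rate lies below all the admissible members of a finite set. -/
theorem exists_isRate_forall_notMem (τ : TimeDomain) {s : Set ℝ} (hs : s.Finite) :
    ∃ ρ, τ.IsRate ρ ∧ ∀ μ, τ.IsRate μ → μ ≤ ρ → μ ∉ s := by
  induction s, hs using Set.Finite.induction_on with
  | empty => exact (τ.exists_isRate).imp fun ρ hρ => ⟨hρ, by simp⟩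
  | @insert a s _ _ ih =>
    obtain ⟨ρ, hρ, h⟩ := ih
    by_cases ha : τ.IsRate a ∧ a ≤ ρ
    · obtain ⟨ρ', hρ', hlt⟩ := (τ.isRate_infinite_of_lt ha.1).nonempty
      refine ⟨ρ', hρ', fun μ hμ hle hmem => ?_⟩
      rcases hmem with rfl | hmem
      · exact absurd hlt (not_lt.2 hle)
      · exact h μ hμ (hle.trans (hlt.le.trans ha.2)) hmem
    · refine ⟨ρ, hρ, fun μ hμ hle hmem => ?_⟩
      rcases hmem with rfl | hmem
      · exact ha ⟨hμ, hle⟩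
      · exact h μ hμ hle hmem

theorem IsRate.mem_stableRegion {τ : TimeDomain} {μ : ℝ} (h : τ.IsRate μ) :
    (μ : ℂ) ∈ τ.stableRegion := by
  cases τ with
  | continuous => simpa [stableRegion, IsRate] using h
  | discrete =>
    simp only [stableRegion, Set.mem_ofPred_eq, Complex.norm_real, Real.norm_eq_abs]
    rw [abs_of_pos h.1]
    exact h.2

theorem IsRate.mem_torsionAt {X : Type*} [AddCommGroup X] [Module ℝ X] {τ : TimeDomain} {μ : ℝ}
    (h : τ.IsRate μ) {f : Module.End ℝ X} {v : X} (hv : f v = μ • v) :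
    v ∈ f.torsionAt τ.stableRegion := by
  refine Module.End.mem_torsionAt.2 ⟨Polynomial.X - Polynomial.C μ, fun z hz => ?_, ?_⟩
  · have : z = μ := by simpa [sub_eq_zero] using hz
    exact this ▸ h.mem_stableRegion
  · simp [hv]

end TimeDomain

/-! ### Friends, reachability subspaces and the stabilisability subspace -/

namespace LTISystem

variable {n m : ℕ} {κ : Type} (S : LTISystem n m κ)

theorem closedA_mulVec (F : Matrix (Fin m) (Fin n) ℝ) (v : Fin n → ℝ) :
    S.closedA F *ᵥ v = S.A *ᵥ v + S.B *ᵥ (F *ᵥ v) := by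
  simp [closedA, add_mulVec]

theorem closedC_mulVec (F : Matrix (Fin m) (Fin n) ℝ) (v : Fin n → ℝ) :
    S.closedC F *ᵥ v = S.C *ᵥ v + S.D *ᵥ (F *ᵥ v) := by
  simp [closedC, add_mulVec]

theorem isFriend_iff {S : LTISystem n m κ} {V : Submodule ℝ (Fin n → ℝ)}
    {F : Matrix (Fin m) (Fin n) ℝ} :
    S.IsFriend V F ↔ ∀ v ∈ V, S.closedA F *ᵥ v ∈ V ∧ S.closedC F *ᵥ v = 0 :=
  ⟨fun h v hv => ⟨h.1 v hv, h.2 hv⟩, fun h => ⟨fun v hv => (h v hv).1, fun v hv => (h v hv).2⟩⟩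

/-- The inputs that do not act on the output and drive the state within `V`. -/
def nullInputs (V : Submodule ℝ (Fin n → ℝ)) : Submodule ℝ (Fin m → ℝ) :=
  LinearMap.ker S.D.mulVecLin ⊓ V.comap S.B.mulVecLin

theorem mem_nullInputs {S : LTISystem n m κ} {V : Submodule ℝ (Fin n → ℝ)} {w : Fin m → ℝ} :
    w ∈ S.nullInputs V ↔ S.D *ᵥ w = 0 ∧ S.B *ᵥ w ∈ V := Iff.rfl

theorem map_nullInputs (V : Submodule ℝ (Fin n → ℝ)) :
    (S.nullInputs V).map S.B.mulVecLin =
      V ⊓ (LinearMap.ker S.D.mulVecLin).map S.B.mulVecLin := by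
  ext x
  constructor
  · rintro ⟨w, hw, rfl⟩
    exact ⟨hw.2, w, hw.1, rfl⟩
  · rintro ⟨hx, w, hw, rfl⟩
    exact ⟨w, ⟨hw, hx⟩, rfl⟩

theorem map_nullInputs_le (V : Submodule ℝ (Fin n → ℝ)) :
    (S.nullInputs V).map S.B.mulVecLin ≤ V :=
  (S.map_nullInputs V).trans_le inf_le_left

/-- Inputs may be chosen pointwise: the admissible pairs (state, input) form a subspace projecting
onto `V`, and a linear section of the projection, extended to the whole space, is a feedback. -/
theorem exists_isFriend_iff {V : Submodule ℝ (Fin n → ℝ)} :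
    (∃ F, S.IsFriend V F) ↔
      ∀ v ∈ V, ∃ w : Fin m → ℝ, S.A *ᵥ v + S.B *ᵥ w ∈ V ∧ S.C *ᵥ v + S.D *ᵥ w = 0 := by
  constructor
  · rintro ⟨F, hF⟩ v hv
    have := isFriend_iff.1 hF v hv
    rw [closedA_mulVec, closedC_mulVec] at this
    exact ⟨F *ᵥ v, this⟩
  · intro h
    let P : Submodule ℝ ((Fin n → ℝ) × (Fin m → ℝ)) :=
      V.comap (LinearMap.fst ℝ _ _) ⊓
      (V.comap (S.A.mulVecLin.coprod S.B.mulVecLin) ⊓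
        LinearMap.ker (S.C.mulVecLin.coprod S.D.mulVecLin))
    let π : P →ₗ[ℝ] V := ((LinearMap.fst ℝ _ _).comp P.subtype).codRestrict V fun x => x.2.1
    have hπ : LinearMap.range π = ⊤ := by
      refine LinearMap.range_eq_top.2 fun v => ?_
      obtain ⟨w, hw⟩ := h v v.2
      exact ⟨⟨(v, w), v.2, hw.1, hw.2⟩, rfl⟩
    obtain ⟨s, hs⟩ := π.exists_rightInverse_of_surjective hπ
    obtain ⟨g, hg⟩ := LinearMap.exists_extend (((LinearMap.snd ℝ _ _).comp P.subtype).comp s)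
    refine ⟨LinearMap.toMatrix' g, isFriend_iff.2 fun v hv => ?_⟩
    have h1 : ((s ⟨v, hv⟩ : P) : (Fin n → ℝ) × (Fin m → ℝ)).1 = v :=
      congrArg Subtype.val (LinearMap.congr_fun hs ⟨v, hv⟩)
    have h2 : ((s ⟨v, hv⟩ : P) : (Fin n → ℝ) × (Fin m → ℝ)).2 = g v :=
      (LinearMap.congr_fun hg ⟨v, hv⟩).symm
    have h3 := (s ⟨v, hv⟩).2.2
    rw [closedA_mulVec, closedC_mulVec, LinearMap.toMatrix'_mulVec, ← h2]
    nth_rw 1 [← h1]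
    nth_rw 3 [← h1]
    exact ⟨h3.1, h3.2⟩

theorem exists_isFriend_sSup {s : Set (Submodule ℝ (Fin n → ℝ))}
    (hs : ∀ V ∈ s, ∃ F, S.IsFriend V F) : ∃ F, S.IsFriend (sSup s) F := by
  rw [exists_isFriend_iff]
  let P : Submodule ℝ (Fin n → ℝ) :=
    (((sSup s).comap (S.A.mulVecLin.coprod S.B.mulVecLin)) ⊓
      LinearMap.ker (S.C.mulVecLin.coprod S.D.mulVecLin)).map (LinearMap.fst ℝ _ (Fin m → ℝ))
  suffices h : sSup s ≤ P by
    intro v hv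
    obtain ⟨⟨v', w⟩, hw, rfl⟩ := h hv
    exact ⟨w, hw.1, hw.2⟩
  refine sSup_le fun V hV v hv => ?_
  obtain ⟨w, h1, h2⟩ := S.exists_isFriend_iff.1 (hs V hV) v hv
  exact ⟨(v, w), ⟨le_sSup hV h1, h2⟩, rfl⟩

/-- Two friends of nested output-nulling subspaces differ by inputs that do not act on the
output. -/
theorem IsFriend.mulVec_sub_mem {S : LTISystem n m κ} {V W : Submodule ℝ (Fin n → ℝ)}
    {F F' : Matrix (Fin m) (Fin n) ℝ} (hF : S.IsFriend V F) (hF' : S.IsFriend W F') (hVW : V ≤ W)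
    {v : Fin n → ℝ} (hv : v ∈ V) : F' *ᵥ v - F *ᵥ v ∈ S.nullInputs W := by
  obtain ⟨h1, h2⟩ := isFriend_iff.1 hF v hv
  obtain ⟨h1', h2'⟩ := isFriend_iff.1 hF' v (hVW hv)
  rw [closedA_mulVec] at h1 h1'
  rw [closedC_mulVec] at h2 h2'
  refine mem_nullInputs.2 ⟨?_, ?_⟩
  · rw [mulVec_sub, ← add_sub_add_left_eq_sub _ _ (S.C *ᵥ v), h2, h2', sub_zero]
  · rw [mulVec_sub, ← add_sub_add_left_eq_sub _ _ (S.A *ᵥ v)]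
    exact W.sub_mem h1' (hVW h1)

theorem IsFriend.closedA_mulVec_sub_mem {S : LTISystem n m κ} {V W : Submodule ℝ (Fin n → ℝ)}
    {F F' : Matrix (Fin m) (Fin n) ℝ} (hF : S.IsFriend V F) (hF' : S.IsFriend W F') (hVW : V ≤ W)
    {v : Fin n → ℝ} (hv : v ∈ V) :
    S.closedA F' *ᵥ v - S.closedA F *ᵥ v ∈ (S.nullInputs W).map S.B.mulVecLin :=
  ⟨_, hF.mulVec_sub_mem hF' hVW hv, by
    rw [closedA_mulVec, closedA_mulVec, add_sub_add_left_eq_sub, ← mulVec_sub]; rfl⟩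

theorem exists_isFriend_Vstar : ∃ F, S.IsFriend S.Vstar F :=
  S.exists_isFriend_sSup fun _ h => h

theorem IsFriend.le_Vstar {S : LTISystem n m κ} {V : Submodule ℝ (Fin n → ℝ)}
    {F : Matrix (Fin m) (Fin n) ℝ} (hF : S.IsFriend V F) : V ≤ S.Vstar :=
  le_sSup ⟨F, hF⟩

theorem IsFriend.removeOutput {S : LTISystem n m κ} {V : Submodule ℝ (Fin n → ℝ)}
    {F : Matrix (Fin m) (Fin n) ℝ} (hF : S.IsFriend V F) (j : κ) :
    (S.removeOutput j).IsFriend V F := by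
  refine isFriend_iff.2 fun v hv => ⟨(isFriend_iff.1 hF v hv).1, ?_⟩
  have h := (isFriend_iff.1 hF v hv).2
  rw [closedC_mulVec] at h ⊢
  ext i
  exact congrFun h i

theorem Rstar_le_of_isFriend {F : Matrix (Fin m) (Fin n) ℝ} (hF : S.IsFriend S.Vstar F)
    {W : Submodule ℝ (Fin n → ℝ)} (hW : (S.nullInputs S.Vstar).map S.B.mulVecLin ≤ W)
    (hinv : ∀ v ∈ W, S.closedA F *ᵥ v ∈ W) : S.Rstar ≤ W :=
  sInf_le ⟨S.map_nullInputs _ ▸ hW, F, hF, hinv⟩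

theorem map_nullInputs_le_Rstar : (S.nullInputs S.Vstar).map S.B.mulVecLin ≤ S.Rstar := by
  rw [map_nullInputs]
  exact le_sInf fun W hW => hW.1

theorem Rstar_le_Vstar : S.Rstar ≤ S.Vstar := by
  obtain ⟨F, hF⟩ := S.exists_isFriend_Vstar
  exact S.Rstar_le_of_isFriend hF (S.map_nullInputs_le _) hF.1

/-- The competitors defining `R*` may use different friends, but these differ on `V*` by vectors
that every competitor contains. -/
theorem IsFriend.closedA_mulVec_mem_Rstar {S : LTISystem n m κ} {F : Matrix (Fin m) (Fin n) ℝ}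
    (hF : S.IsFriend S.Vstar F) {v : Fin n → ℝ} (hv : v ∈ S.Rstar) :
    S.closedA F *ᵥ v ∈ S.Rstar := by
  refine Submodule.mem_sInf.2 ?_
  rintro W ⟨hW, F', hF', hinv⟩
  have h1 : S.closedA F' *ᵥ v ∈ W := hinv v (Submodule.mem_sInf.1 hv W ⟨hW, F', hF', hinv⟩)
  rw [← map_nullInputs] at hW
  have h2 := hW (hF'.closedA_mulVec_sub_mem hF le_rfl (S.Rstar_le_Vstar hv))
  simpa using W.add_mem h2 h1

/-- `R*` is spanned by the subspaces `R*(μ)`, where `μ` ranges over an infinite set. -/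
theorem Rstar_le_iSup_RstarAt {L : Set ℝ} (hL : L.Infinite) :
    S.Rstar ≤ ⨆ μ ∈ L, S.RstarAt μ := by
  obtain ⟨F, hF⟩ := S.exists_isFriend_Vstar
  refine (S.Rstar_le_of_isFriend hF
    (le_shiftedPreimages hL (S.map_nullInputs_le _) hF.1)
    (apply_mem_shiftedPreimages hL (S.map_nullInputs_le _) hF.1)).trans
    (iSup₂_mono fun μ _ => ?_)
  rintro v ⟨hv, w, hw, hBw⟩
  have hBw' : S.B *ᵥ w = S.closedA F *ᵥ v - μ • v := hBw
  -- The defect of `v` as an eigenvector is `B w` with `w` invisible at the output, so subtracting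
  -- `w` from the feedback input removes it.
  refine ⟨F *ᵥ v - w, ?_, ?_⟩
  · rw [mulVec_sub, hBw', closedA_mulVec, sub_mulVec, smul_mulVec, one_mulVec]
    abel
  · have h := (isFriend_iff.1 hF v hv).2
    rw [closedC_mulVec] at h
    rw [mulVec_sub, (mem_nullInputs.1 hw).1, sub_zero, h]

theorem asymptoticallyStable_iff {τ : TimeDomain} {M : Matrix (Fin n) (Fin n) ℝ} :
    AsymptoticallyStable τ M ↔ Module.End.torsionAt τ.stableRegion M.mulVecLin = ⊤ := by
  rw [AsymptoticallyStable, ← Matrix.charpoly_mulVecLin, Module.End.rootSet_charpoly_subset_iff]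

/-- `F` is a friend of `V` that makes the dynamics on `V` asymptotically stable. -/
def IsStabilisingFriend (τ : TimeDomain) (V : Submodule ℝ (Fin n → ℝ))
    (F : Matrix (Fin m) (Fin n) ℝ) : Prop :=
  S.IsFriend V F ∧ V ≤ Module.End.torsionAt τ.stableRegion (S.closedA F).mulVecLin

theorem VstarG_eq (τ : TimeDomain) :
    S.VstarG τ = sSup {V | ∃ F, S.IsStabilisingFriend τ V F} := by
  rw [VstarG]
  congr 1
  ext V
  refine exists_congr fun F => ⟨?_, ?_⟩
  · rintro ⟨h, hs⟩
    exact ⟨h, (Module.End.rootSet_charpoly_restrict_subset_iff h.1).1 hs⟩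
  · rintro ⟨h, hs⟩
    exact ⟨h, (Module.End.rootSet_charpoly_restrict_subset_iff h.1).2 hs⟩

theorem IsStabilisingFriend.le_VstarG {S : LTISystem n m κ} {τ : TimeDomain}
    {V : Submodule ℝ (Fin n → ℝ)} {F : Matrix (Fin m) (Fin n) ℝ}
    (hF : S.IsStabilisingFriend τ V F) : V ≤ S.VstarG τ := by
  rw [VstarG_eq]
  exact le_sSup ⟨F, hF⟩

/-- A friend `F` of `V` can be changed so that the generalized reachable vectors of `V` become
sums of eigenvectors, with eigenvalues in a prescribed infinite set. -/
theorem exists_isFriend_eigenvectors {V : Submodule ℝ (Fin n → ℝ)}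
    {F : Matrix (Fin m) (Fin n) ℝ} (hF : S.IsFriend V F) (L : Set ℝ) :
    ∃ F', S.IsFriend V F' ∧
      ∀ P : Submodule ℝ (Fin n → ℝ), (∀ v, (∃ μ ∈ L, S.closedA F' *ᵥ v = μ • v) → v ∈ P) →
        shiftedPreimages (S.closedA F).mulVecLin V ((S.nullInputs V).map S.B.mulVecLin) L ≤ P := by
  set f := (S.closedA F).mulVecLin with hf
  set U := (S.nullInputs V).map S.B.mulVecLin with hU
  let G : Set (Fin n → ℝ) := {v | v ∈ V ∧ ∃ μ ∈ L, f v - μ • v ∈ U}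
  have hspan : shiftedPreimages f V U L ≤ Submodule.span ℝ G :=
    iSup₂_le fun μ hμ v hv => Submodule.subset_span ⟨hv.1, μ, hμ, hv.2⟩
  -- The correcting inputs are chosen vector by vector; on an independent spanning subset of `G`
  -- they extend to one linear map.
  obtain ⟨b, hbG, hbspan, hb⟩ := exists_linearIndependent ℝ G
  have hinp : ∀ v : b, ∃ w : S.nullInputs V, ∃ μ ∈ L,
      f (v : Fin n → ℝ) + S.B *ᵥ (w : Fin m → ℝ) = μ • (v : Fin n → ℝ) := by
    rintro ⟨v, hv⟩
    obtain ⟨-, μ, hμ, w, hw, hBw⟩ := hbG hv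
    refine ⟨-⟨w, hw⟩, μ, hμ, ?_⟩
    have hBw' : S.B *ᵥ w = f v - μ • v := hBw
    simp [mulVec_neg, hBw']
  choose w μ hμ hw using hinp
  let e := Module.Basis.span hb
  obtain ⟨h, hh⟩ := LinearMap.exists_extend (e.constr ℝ w)
  have hhb : ∀ v : b, h v = w v := fun v => by
    have h1 := LinearMap.congr_fun hh (e v)
    rw [Module.Basis.constr_basis] at h1
    rw [← h1]
    simp [e, Module.Basis.span_apply]
  let F' := F + LinearMap.toMatrix' ((S.nullInputs V).subtype.comp h)
  have hF'v : ∀ v, F' *ᵥ v = F *ᵥ v + (h v : Fin m → ℝ) := fun v => by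
    simp only [F', add_mulVec, LinearMap.toMatrix'_mulVec]
    rfl
  refine ⟨F', isFriend_iff.2 fun v hv => ?_, fun P hP => ?_⟩
  · obtain ⟨h1, h2⟩ := isFriend_iff.1 hF v hv
    obtain ⟨h3, h4⟩ := mem_nullInputs.1 (h v).2
    rw [closedA_mulVec] at h1
    rw [closedC_mulVec] at h2
    rw [closedA_mulVec, closedC_mulVec, hF'v, mulVec_add, mulVec_add, ← add_assoc, ← add_assoc,
      h2, h3, add_zero]
    exact ⟨V.add_mem h1 h4, rfl⟩
  · refine hspan.trans ?_
    rw [← hbspan]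
    refine Submodule.span_le.2 fun v hv => hP v ⟨μ ⟨v, hv⟩, hμ _, ?_⟩
    rw [closedA_mulVec, hF'v, mulVec_add, ← add_assoc, ← closedA_mulVec, hhb ⟨v, hv⟩]
    exact hw ⟨v, hv⟩

/-- The supremum is attained. On the reachable part `W` a friend can be given admissible real
eigenvalues. Modulo `W` all friends agree, so there each summand keeps the stable spectrum given by
its own friend. -/
theorem exists_isStabilisingFriend_VstarG (τ : TimeDomain) :
    ∃ F, S.IsStabilisingFriend τ (S.VstarG τ) F := by
  have hVeq := S.VstarG_eq τ
  obtain ⟨F, hF⟩ : ∃ F, S.IsFriend (S.VstarG τ) F := by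
    rw [hVeq]
    exact S.exists_isFriend_sSup fun V ⟨F, hF⟩ => ⟨F, hF.1⟩
  obtain ⟨ρ, hρ⟩ := τ.exists_isRate
  have hL := (τ.isRate_infinite_of_lt hρ).mono fun μ hμ => hμ.1
  obtain ⟨F', hF', heig⟩ := S.exists_isFriend_eigenvectors hF {μ | τ.IsRate μ}
  set W := shiftedPreimages (S.closedA F).mulVecLin (S.VstarG τ)
    ((S.nullInputs (S.VstarG τ)).map S.B.mulVecLin) {μ | τ.IsRate μ} with hWdef
  have hUW : (S.nullInputs (S.VstarG τ)).map S.B.mulVecLin ≤ W :=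
    le_shiftedPreimages hL (S.map_nullInputs_le _) hF.1
  have hWV : W ≤ S.VstarG τ := shiftedPreimages_le _ _ _ _
  have hWinv : ∀ v ∈ W, (S.closedA F').mulVecLin v ∈ W := fun v hv => by
    have h1 := apply_mem_shiftedPreimages hL (S.map_nullInputs_le _) hF.1 v hv
    have h2 := hUW (hF.closedA_mulVec_sub_mem hF' le_rfl (hWV hv))
    have h3 := W.add_mem h2 h1
    simpa using h3
  have hWtor : W ≤ Module.End.torsionAt τ.stableRegion (S.closedA F').mulVecLin :=
    heig _ fun v ⟨μ, hμ, hv⟩ => TimeDomain.IsRate.mem_torsionAt hμ hv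
  have hquot : S.VstarG τ ≤ Module.End.torsionIn τ.stableRegion (S.closedA F').mulVecLin W hWinv := by
    conv_lhs => rw [hVeq]
    refine sSup_le ?_
    rintro V ⟨F₁, hF₁, hst⟩ v hv
    obtain ⟨q, hq, h0⟩ := Module.End.mem_torsionAt.1 (hst hv)
    refine ⟨q, hq, ?_⟩
    have hle : V ≤ S.VstarG τ := IsStabilisingFriend.le_VstarG ⟨hF₁, hst⟩
    have := Module.End.aeval_apply_sub_mem hF₁.1 hWinv
      (fun u hu => hUW (hF₁.closedA_mulVec_sub_mem hF' hle hu)) q hv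
    rwa [h0, sub_zero] at this
  refine ⟨F', hF', fun v hv => ?_⟩
  obtain ⟨q, hq, hqv⟩ := hquot hv
  exact Module.End.mem_torsionAt_of_aeval_mem hq (hWtor hqv)

end LTISystem

/-! ### Monotone errors and single modes -/

/-- A solution of `e' = μ e` on `[0, ∞)` is exponential. -/
theorem eq_mul_exp_of_hasDerivWithinAt {e : ℝ → ℝ} {μ : ℝ}
    (he : ∀ t, 0 ≤ t → HasDerivWithinAt e (μ * e t) (Set.Ici 0) t) {t : ℝ} (ht : 0 ≤ t) :
    e t = e 0 * Real.exp (μ * t) := by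
  have hd : ∀ s ∈ Set.Ici (0 : ℝ),
      HasDerivWithinAt (fun s => e s * Real.exp (-μ * s)) 0 (Set.Ici 0) s := fun s hs => by
    have h1 : HasDerivAt (fun s : ℝ => Real.exp (-μ * s)) (Real.exp (-μ * s) * (-μ * 1)) s :=
      ((hasDerivAt_id s).const_mul (-μ)).exp
    convert! (he s hs).mul h1.hasDerivWithinAt using 1
    ring
  have h := (convex_Ici (0 : ℝ)).is_const_of_fderivWithin_eq_zero (𝕜 := ℝ)
    (fun s hs => (hd s hs).differentiableWithinAt)
    (fun s hs => by
      rw [(hd s hs).hasFDerivWithinAt.fderivWithin (uniqueDiffOn_Ici 0 s hs)]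
      simp)
    (Set.mem_Ici.2 ht) (Set.mem_Ici.2 le_rfl)
  simp only [mul_zero, Real.exp_zero, mul_one] at h
  rw [← h, mul_assoc, ← Real.exp_add]
  simp

/-- If the functionals `φ` and `φ ∘ f` vanish on the kernel of a single functional, then `φ` is an
eigenvector of the transpose of `f`. -/
theorem exists_forall_apply_eq_mul {X : Type*} [AddCommGroup X] [Module ℝ X]
    [FiniteDimensional ℝ X] {f : Module.End ℝ X} {φ ψ : X →ₗ[ℝ] ℝ}
    (h : ∀ x, ψ x = 0 → φ x = 0 ∧ φ (f x) = 0) : ∃ μ : ℝ, ∀ x, φ (f x) = μ * φ x := by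
  have key : ∀ χ : X →ₗ[ℝ] ℝ, (∀ x, ψ x = 0 → χ x = 0) → ∃ a : ℝ, a • ψ = χ := fun χ hχ => by
    have := FiniteDimensional.mem_span_of_iInf_ker_le_ker (L := fun _ : Unit => ψ) (K := χ)
      (by rw [iInf_const]; exact hχ)
    rwa [Set.range_const, Submodule.mem_span_singleton] at this
  obtain ⟨a, ha⟩ := key φ fun x hx => (h x hx).1
  obtain ⟨b, hb⟩ := key (φ.comp f) fun x hx => (h x hx).2
  rcases eq_or_ne a 0 with rfl | ha0
  · refine ⟨0, fun x => ?_⟩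
    rw [← ha]
    simp
  · refine ⟨b / a, fun x => ?_⟩
    have h1 : b * ψ x = φ (f x) := LinearMap.congr_fun hb x
    have h2 : a * ψ x = φ x := LinearMap.congr_fun ha x
    rw [← h1, ← h2]
    field_simp

namespace LTISystem

variable {n m : ℕ} {κ : Type} (S : LTISystem n m κ)

/-- The `k`-th component of the closed-loop output, as a functional of the state. -/
noncomputable def closedOutput (F : Matrix (Fin m) (Fin n) ℝ) (k : κ) : (Fin n → ℝ) →ₗ[ℝ] ℝ :=
  (LinearMap.proj k).comp (S.closedC F).mulVecLin

theorem closedOutput_apply (F : Matrix (Fin m) (Fin n) ℝ) (k : κ) (x : Fin n → ℝ) :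
    S.closedOutput F k x = (S.closedC F *ᵥ x) k := rfl

theorem IsSteadyState.trackingError_eq {τ : TimeDomain} {S : LTISystem n m κ}
    {F : Matrix (Fin m) (Fin n) ℝ} {xss : Fin n → ℝ} {uss : Fin m → ℝ} {r : κ → ℝ}
    (h : IsSteadyState τ S xss uss r) (x : Fin n → ℝ) (k : κ) :
    S.trackingError F xss uss r x k = S.closedOutput F k (x - xss) := by
  have hr : r = S.C *ᵥ xss + S.D *ᵥ uss := by
    cases τ <;> exact h.2
  rw [closedOutput_apply, closedC_mulVec, trackingError, trackingInput, hr, mulVec_add,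
    mulVec_sub S.C]
  simp only [Pi.add_apply, Pi.sub_apply]
  ring

theorem IsSteadyState.continuous_vectorField_eq {S : LTISystem n m κ}
    {xss : Fin n → ℝ} {uss : Fin m → ℝ} {r : κ → ℝ}
    (h : IsSteadyState .continuous S xss uss r) (F : Matrix (Fin m) (Fin n) ℝ) (x : Fin n → ℝ) :
    S.A *ᵥ x + S.B *ᵥ trackingInput F xss uss x = S.closedA F *ᵥ (x - xss) := by
  have h1 := h.1
  rw [closedA_mulVec, trackingInput, mulVec_add, mulVec_sub S.A,
    eq_neg_of_add_eq_zero_left h1.symm]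
  abel

theorem IsSteadyState.discrete_step_eq {S : LTISystem n m κ}
    {xss : Fin n → ℝ} {uss : Fin m → ℝ} {r : κ → ℝ}
    (h : IsSteadyState .discrete S xss uss r) (F : Matrix (Fin m) (Fin n) ℝ) (x : Fin n → ℝ) :
    S.A *ᵥ x + S.B *ᵥ trackingInput F xss uss x = S.closedA F *ᵥ (x - xss) + xss := by
  have h1 := h.1
  conv_rhs => rw [h1]
  rw [closedA_mulVec, trackingInput, mulVec_add, ← h1, mulVec_sub S.A]
  have h2 : S.B *ᵥ uss = xss - S.A *ᵥ xss := eq_sub_of_add_eq' h1.symm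
  rw [h2]
  abel

theorem isSteadyState_zero (τ : TimeDomain) : IsSteadyState τ S 0 0 0 := by
  cases τ <;> simp [IsSteadyState]

/-- Every closed-loop output is an eigenfunctional of the closed loop, with an admissible eigenvalue
not above the rate `ρ`. -/
def HasSingleModeOutputs (τ : TimeDomain) (ρ : ℝ) (F : Matrix (Fin m) (Fin n) ℝ) : Prop :=
  ∀ k, ∃ μ, τ.IsRate μ ∧ μ ≤ ρ ∧
    ∀ x, S.closedOutput F k (S.closedA F *ᵥ x) = μ * S.closedOutput F k x

theorem HasSingleModeOutputs.solves_continuous {S : LTISystem n m κ} {ρ : ℝ}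
    {F : Matrix (Fin m) (Fin n) ℝ} (hst : AsymptoticallyStable .continuous (S.closedA F))
    (h : S.HasSingleModeOutputs .continuous ρ F) :
    SolvesGlobalMonotonicity .continuous S ρ F := by
  refine ⟨hst, fun r xss uss hss x hx k => ?_⟩
  obtain ⟨μ, hμ, hμρ, hmode⟩ := h k
  simp only [hss.trackingError_eq]
  have hμ0 : μ < 0 := hμ
  set e : ℝ → ℝ := fun t => S.closedOutput F k (x t - xss)
  have hder : ∀ t, 0 ≤ t → HasDerivWithinAt e (μ * e t) (Set.Ici 0) t := fun t ht => by
    have h1 := hx t ht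
    rw [hss.continuous_vectorField_eq] at h1
    have h2 := (S.closedOutput F k).toContinuousLinearMap.hasFDerivAt.comp_hasDerivWithinAt t
      (h1.sub_const xss)
    have h3 := hmode (x t - xss)
    rw [← h3]
    exact h2
  have hsol : ∀ t, 0 ≤ t → e t = e 0 * Real.exp (μ * t) := fun t ht =>
    eq_mul_exp_of_hasDerivWithinAt hder ht
  refine ⟨⟨|e 0|, fun t ht => ?_⟩, ?_⟩
  · change |e t| ≤ _
    rw [hsol t ht, abs_mul, Real.abs_exp]
    gcongr
  · have hexp : ∀ s t, s < t → Real.exp (μ * t) < Real.exp (μ * s) := fun s t hst =>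
      Real.exp_lt_exp.2 (mul_lt_mul_of_neg_left hst hμ0)
    rcases lt_trichotomy (e 0) 0 with h0 | h0 | h0
    · refine Or.inr (Or.inl fun s hs t ht hst => ?_)
      rw [hsol s hs, hsol t ht]
      exact mul_lt_mul_of_neg_left (hexp s t hst) h0
    · refine Or.inl fun t ht => ?_
      rw [hsol t ht, h0, zero_mul]
    · refine Or.inr (Or.inr fun s hs t ht hst => ?_)
      rw [hsol s hs, hsol t ht]
      exact mul_lt_mul_of_pos_left (hexp s t hst) h0

theorem HasSingleModeOutputs.solves_discrete {S : LTISystem n m κ} {ρ : ℝ}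
    {F : Matrix (Fin m) (Fin n) ℝ} (hst : AsymptoticallyStable .discrete (S.closedA F))
    (h : S.HasSingleModeOutputs .discrete ρ F) :
    SolvesGlobalMonotonicity .discrete S ρ F := by
  refine ⟨hst, fun r xss uss hss x hx k => ?_⟩
  obtain ⟨μ, ⟨hμ0, hμ1⟩, hμρ, hmode⟩ := h k
  simp only [hss.trackingError_eq]
  set e : ℕ → ℝ := fun t => S.closedOutput F k (x t - xss) with he
  have hsol : ∀ t, e t = e 0 * μ ^ t := fun t => by
    induction t with
    | zero => simp
    | succ t ih =>
      have h1 : e (t + 1) = μ * e t := by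
        simp only [he]
        rw [hx, hss.discrete_step_eq, add_sub_cancel_right, hmode]
      rw [h1, ih]
      ring
  refine ⟨⟨|e 0|, fun t => ?_⟩, ?_⟩
  · change |e t| ≤ _
    rw [hsol t, abs_mul, abs_of_pos (pow_pos hμ0 t)]
    gcongr
  · have hpow : ∀ s t, s < t → μ ^ t < μ ^ s := fun s t hst =>
      pow_lt_pow_right_of_lt_one₀ hμ0 hμ1 hst
    rcases lt_trichotomy (e 0) 0 with h0 | h0 | h0
    · refine Or.inr (Or.inl fun s t hst => ?_)
      rw [hsol s, hsol t]
      exact mul_lt_mul_of_neg_left (hpow s t hst) h0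
    · refine Or.inl fun t => ?_
      rw [hsol t, h0, zero_mul]
    · refine Or.inr (Or.inr fun s t hst => ?_)
      rw [hsol s, hsol t]
      exact mul_lt_mul_of_pos_left (hpow s t hst) h0

theorem hasSingleModeOutputs_continuous {S : LTISystem n m κ} {ρ : ℝ}
    (hρ : TimeDomain.continuous.IsRate ρ) {F : Matrix (Fin m) (Fin n) ℝ}
    (h : SolvesGlobalMonotonicity .continuous S ρ F) :
    S.HasSingleModeOutputs .continuous ρ F := by
  intro k
  -- The zero equilibrium suffices: its errors are the outputs of all free closed-loop motions.
  have hss := S.isSteadyState_zero .continuous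
  let φ : (Fin n → ℝ) →L[ℝ] ℝ := (S.closedOutput F k).toContinuousLinearMap
  let f : (Fin n → ℝ) →L[ℝ] (Fin n → ℝ) := (S.closedA F).mulVecLin.toContinuousLinearMap
  have hx : ∀ x₀ t, HasDerivAt (fun t : ℝ => NormedSpace.exp (t • f) x₀)
      (f (NormedSpace.exp (t • f) x₀)) t := fun x₀ t => by
    have h1 := (hasDerivAt_exp_smul_const' (𝕂 := ℝ) f t).clm_apply (hasDerivAt_const t x₀)
    simpa using h1
  have he : ∀ x₀ t, HasDerivAt (fun t : ℝ => φ (NormedSpace.exp (t • f) x₀))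
      (φ (f (NormedSpace.exp (t • f) x₀))) t := fun x₀ t =>
    φ.hasFDerivAt.comp_hasDerivAt t (hx x₀ t)
  have hprop : ∀ x₀, (∃ β : ℝ, ∀ t, 0 ≤ t → |φ (NormedSpace.exp (t • f) x₀)| ≤
      β * Real.exp (ρ * t)) ∧
      StrictlyMonotonicOrZeroCont (fun t => φ (NormedSpace.exp (t • f) x₀)) := fun x₀ => by
    have h1 := h.2 0 0 0 hss (fun t => NormedSpace.exp (t • f) x₀) (fun t _ => by
      rw [hss.continuous_vectorField_eq, sub_zero]
      exact (hx x₀ t).hasDerivWithinAt) k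
    simp only [hss.trackingError_eq, sub_zero] at h1
    exact h1
  have h0 : ∀ x₀, NormedSpace.exp ((0 : ℝ) • f) x₀ = x₀ := fun x₀ => by
    rw [zero_smul, NormedSpace.exp_zero]
    rfl
  -- Here `ψ` is the output at time 1 minus the output at time 0; its vanishing excludes strict
  -- monotonicity.
  obtain ⟨μ, hμ⟩ := exists_forall_apply_eq_mul (f := (S.closedA F).mulVecLin)
    (φ := S.closedOutput F k)
    (ψ := ((φ.comp (NormedSpace.exp ((1 : ℝ) • f)) - φ : (Fin n → ℝ) →L[ℝ] ℝ) :
      (Fin n → ℝ) →ₗ[ℝ] ℝ)) fun x₀ hx₀ => by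
    have h01 : φ (NormedSpace.exp ((1 : ℝ) • f) x₀) = φ (NormedSpace.exp ((0 : ℝ) • f) x₀) := by
      rw [h0]
      exact sub_eq_zero.1 hx₀
    have hz : ∀ t : ℝ, 0 ≤ t → φ (NormedSpace.exp (t • f) x₀) = 0 := by
      rcases (hprop x₀).2 with hz | hmono | hanti
      · exact hz
      · exact absurd h01 (hmono (Set.mem_Ici.2 le_rfl) (Set.mem_Ici.2 zero_le_one) zero_lt_one).ne'
      · exact absurd h01 (hanti (Set.mem_Ici.2 le_rfl) (Set.mem_Ici.2 zero_le_one) zero_lt_one).ne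
    refine ⟨by have h1 := hz 0 le_rfl; rwa [h0] at h1, ?_⟩
    have h1 := (he x₀ 0).hasDerivWithinAt (s := Set.Ici 0)
    have h2 : HasDerivWithinAt (fun t : ℝ => φ (NormedSpace.exp (t • f) x₀)) 0 (Set.Ici 0) 0 :=
      (hasDerivWithinAt_const (0 : ℝ) (Set.Ici 0) (0 : ℝ)).congr (fun t ht => hz t ht)
        (hz 0 le_rfl)
    have h3 := (uniqueDiffOn_Ici (0 : ℝ) 0 (Set.mem_Ici.2 le_rfl)).eq_deriv _ h1 h2
    rwa [h0] at h3
  by_cases hφ : ∃ x₀, S.closedOutput F k x₀ ≠ 0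
  · obtain ⟨x₀, hx₀⟩ := hφ
    have hμρ : μ ≤ ρ := by
      have hsol : ∀ t : ℝ, 0 ≤ t → φ (NormedSpace.exp (t • f) x₀) = φ x₀ * Real.exp (μ * t) := by
        intro t ht
        have h1 := eq_mul_exp_of_hasDerivWithinAt (μ := μ)
          (e := fun t : ℝ => φ (NormedSpace.exp (t • f) x₀)) (fun s _ => by
            have h2 : φ (f (NormedSpace.exp (s • f) x₀)) = μ * φ (NormedSpace.exp (s • f) x₀) := hμ _
            rw [← h2]
            exact (he x₀ s).hasDerivWithinAt) ht
        simpa only [h0] using h1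
      obtain ⟨β, hβ⟩ := (hprop x₀).1
      have hpos : 0 < |φ x₀| := abs_pos.2 hx₀
      have hβ0 : 0 < β := by
        have := hβ 0 le_rfl
        rw [h0, mul_zero, Real.exp_zero, mul_one] at this
        exact hpos.trans_le this
      by_contra! hlt
      have hd : 0 < μ - ρ := sub_pos.2 hlt
      -- At this time the bound `exp s ≥ s + 1`, with `s = (μ - ρ) t`, already exceeds `β / |φ x₀|`.
      set t := β / (|φ x₀| * (μ - ρ)) with ht
      have ht0 : 0 ≤ t := by positivity
      have h1 := hβ t ht0
      rw [hsol t ht0, abs_mul, Real.abs_exp, show μ * t = (μ - ρ) * t + ρ * t by ring,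
        Real.exp_add, ← mul_assoc] at h1
      have h2 := le_of_mul_le_mul_right h1 (Real.exp_pos _)
      have h3 : |φ x₀| * ((μ - ρ) * t + 1) ≤ β :=
        (mul_le_mul_of_nonneg_left (Real.add_one_le_exp _) hpos.le).trans h2
      have h4 : |φ x₀| * ((μ - ρ) * t) = β := by
        rw [ht]
        field_simp
      rw [mul_add, h4] at h3
      linarith
    exact ⟨μ, lt_of_le_of_lt hμρ hρ, hμρ, hμ⟩
  · push Not at hφ
    -- For a zero functional any eigenvalue serves.
    exact ⟨ρ, hρ, le_rfl, fun x => by rw [hφ, hφ, mul_zero]⟩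

theorem hasSingleModeOutputs_discrete {S : LTISystem n m κ} {ρ : ℝ}
    (hρ : TimeDomain.discrete.IsRate ρ) {F : Matrix (Fin m) (Fin n) ℝ}
    (h : SolvesGlobalMonotonicity .discrete S ρ F) :
    S.HasSingleModeOutputs .discrete ρ F := by
  intro k
  have hss := S.isSteadyState_zero .discrete
  set φ := S.closedOutput F k
  let f : Module.End ℝ (Fin n → ℝ) := (S.closedA F).mulVecLin
  have hprop : ∀ x₀, (∃ β : ℝ, ∀ t, |φ ((f ^ t) x₀)| ≤ β * ρ ^ t) ∧
      StrictlyMonotonicOrZeroDisc (fun t => φ ((f ^ t) x₀)) := fun x₀ => by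
    have h1 := h.2 0 0 0 hss (fun t => (f ^ t) x₀) (fun t => by
      rw [hss.discrete_step_eq, sub_zero, add_zero, pow_succ', Module.End.mul_apply]
      rfl) k
    simpa only [hss.trackingError_eq, sub_zero] using h1
  obtain ⟨μ, hμ⟩ := exists_forall_apply_eq_mul (f := f) (φ := φ) (ψ := φ.comp f - φ)
    fun x₀ hx₀ => by
    have h01 : φ ((f ^ 1) x₀) = φ ((f ^ 0) x₀) := by
      simpa [sub_eq_zero] using hx₀
    have hz : ∀ t, φ ((f ^ t) x₀) = 0 := by
      rcases (hprop x₀).2 with hz | hmono | hanti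
      · exact hz
      · exact absurd h01 (hmono zero_lt_one).ne'
      · exact absurd h01 (hanti zero_lt_one).ne
    exact ⟨by simpa using hz 0, by simpa using hz 1⟩
  by_cases hφ : ∃ x₀, φ x₀ ≠ 0
  · obtain ⟨x₀, hx₀⟩ := hφ
    have hsol : ∀ t, φ ((f ^ t) x₀) = φ x₀ * μ ^ t := fun t => by
      induction t with
      | zero => simp
      | succ t ih =>
        rw [pow_succ', Module.End.mul_apply, hμ, ih]
        ring
    have hμ0 : 0 < μ := by
      -- For `μ ≤ 0` the factors 1, `μ`, `μ ^ 2` at times 0, 1, 2 go down and then do not go down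
      -- again, so no nonzero multiple is strictly monotonic.
      by_contra! hle
      have hsq : 0 ≤ μ ^ 2 := sq_nonneg μ
      rcases (hprop x₀).2 with hz | hmono | hanti
      · exact hx₀ (by simpa using hz 0)
      · have h1 := hmono zero_lt_one
        have h2 := hmono one_lt_two
        simp only [hsol] at h1 h2
        simp only [pow_zero, pow_one, mul_one] at h1 h2
        rcases lt_or_gt_of_ne hx₀ with hneg | hpos
        · linarith [mul_nonneg_of_nonpos_of_nonpos hneg.le hle,
            mul_nonpos_of_nonpos_of_nonneg hneg.le hsq]
        · linarith [mul_nonpos_of_nonneg_of_nonpos hpos.le hle, mul_nonneg hpos.le hsq]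
      · have h1 := hanti zero_lt_one
        have h2 := hanti one_lt_two
        simp only [hsol] at h1 h2
        simp only [pow_zero, pow_one, mul_one] at h1 h2
        rcases lt_or_gt_of_ne hx₀ with hneg | hpos
        · linarith [mul_nonneg_of_nonpos_of_nonpos hneg.le hle,
            mul_nonpos_of_nonpos_of_nonneg hneg.le hsq]
        · linarith [mul_nonpos_of_nonneg_of_nonpos hpos.le hle, mul_nonneg hpos.le hsq]
    have hμρ : μ ≤ ρ := by
      obtain ⟨β, hβ⟩ := (hprop x₀).1
      have hpos : 0 < |φ x₀| := abs_pos.2 hx₀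
      have hρ0 : 0 < ρ := hρ.1
      by_contra! hlt
      obtain ⟨t, ht⟩ := pow_unbounded_of_one_lt (β / |φ x₀|) ((one_lt_div hρ0).2 hlt)
      have h1 := hβ t
      rw [hsol, abs_mul, abs_of_pos (pow_pos hμ0 t)] at h1
      rw [div_pow, div_lt_div_iff₀ hpos (pow_pos hρ0 t)] at ht
      linarith [mul_comm |φ x₀| (μ ^ t)]
    exact ⟨μ, ⟨hμ0, hμρ.trans_lt hρ.2⟩, hμρ, hμ⟩
  · push Not at hφ
    exact ⟨ρ, hρ, le_rfl, fun x => by rw [hφ, hφ, mul_zero]⟩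

theorem solvesGlobalMonotonicity_iff {τ : TimeDomain} {S : LTISystem n m κ} {ρ : ℝ}
    (hρ : τ.IsRate ρ) {F : Matrix (Fin m) (Fin n) ℝ} :
    SolvesGlobalMonotonicity τ S ρ F ↔
      AsymptoticallyStable τ (S.closedA F) ∧ S.HasSingleModeOutputs τ ρ F := by
  cases τ with
  | continuous =>
    exact ⟨fun h => ⟨h.1, hasSingleModeOutputs_continuous hρ h⟩,
      fun h => h.2.solves_continuous h.1⟩
  | discrete =>
    exact ⟨fun h => ⟨h.1, hasSingleModeOutputs_discrete hρ h⟩,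
      fun h => h.2.solves_discrete h.1⟩

end LTISystem

/-! ### Dimension counts and the two implications -/

theorem Finset.card_le_finrank_map {K X Y ι : Type*} [Field K] [AddCommGroup X] [Module K X]
    [AddCommGroup Y] [Module K Y] [FiniteDimensional K X] {g : X →ₗ[K] Y} {x : ι → X}
    (hx : LinearIndependent K (g ∘ x)) {T : Finset ι} {N : Submodule K X} (hN : ∀ j ∈ T, x j ∈ N) :
    T.card ≤ Module.finrank K (N.map g) := by
  let y : T → N.map g := fun j => ⟨g (x j), Submodule.mem_map_of_mem (hN j j.2)⟩
  have hy : LinearIndependent K y :=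
    LinearIndependent.of_comp (N.map g).subtype (hx.comp (fun j : T => (j : ι)) Subtype.val_injective)
  simpa using hy.fintype_card_le_finrank

namespace LTISystem

variable {n m p : ℕ} {τ : TimeDomain} {S : LTISystem n m (Fin p)}

/-- Under the structural condition, vectors of `R*_j(λ_j)` that are independent modulo `V*_g` can be
found with `λ_j` in prescribed infinite sets. -/
theorem StructuralCondition.exists_linearIndependent
    (hdim : (Module.finrank ℝ ↥(S.VstarG τ) : ℤ) = n - p) (h : S.StructuralCondition τ)
    {L : Fin p → Set ℝ} (hL : ∀ j, (L j).Infinite) :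
    ∃ (lam : Fin p → ℝ) (x : Fin p → Fin n → ℝ), (∀ j, lam j ∈ L j) ∧
      (∀ j, x j ∈ (S.removeOutput j).RstarAt (lam j)) ∧
      LinearIndependent ℝ ((S.VstarG τ).mkQ ∘ x) := by
  have hker := (S.VstarG τ).ker_mkQ
  -- Modulo `V*_g` the summand `n - p` disappears and the structural condition is exactly Rado's.
  obtain ⟨y, hy, hind⟩ := exists_linearIndependent_transversal
    (fun j => ((S.removeOutput j).Rstar).map (S.VstarG τ).mkQ) (fun T => by
      have h1 := Submodule.finrank_map_add_finrank_ker_of_le (S.VstarG τ).mkQ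
        (N := S.VstarG τ ⊔ ⨆ j ∈ T, (S.removeOutput j).Rstar) (hker.le.trans le_sup_left)
      rw [hker] at h1
      have h2 : Submodule.map (S.VstarG τ).mkQ
          (S.VstarG τ ⊔ ⨆ j ∈ T, (S.removeOutput j).Rstar) =
          ⨆ j ∈ T, ((S.removeOutput j).Rstar).map (S.VstarG τ).mkQ := by
        simp [Submodule.map_sup, Submodule.map_iSup]
      rw [h2] at h1
      have h3 := h T
      omega)
  have hcard : Fintype.card (Fin p) = Module.finrank ℝ ((Fin n → ℝ) ⧸ S.VstarG τ) := by
    have h1 := (S.VstarG τ).finrank_quotient_add_finrank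
    rw [Module.finrank_fin_fun] at h1
    rw [Fintype.card_fin]
    omega
  obtain ⟨z, hz, hzind⟩ := hind.exists_mem_of_mem_span hcard
    (fun j => {y | ∃ μ ∈ L j, ∃ x ∈ (S.removeOutput j).RstarAt μ, (S.VstarG τ).mkQ x = y})
    (fun j => by
      have h1 := Submodule.map_mono (f := (S.VstarG τ).mkQ)
        ((S.removeOutput j).Rstar_le_iSup_RstarAt (hL j)) (hy j)
      simp only [Submodule.map_iSup] at h1
      refine (iSup₂_le fun μ hμ => ?_ : _ ≤ Submodule.span ℝ _) h1
      rintro _ ⟨x, hx, rfl⟩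
      exact Submodule.subset_span ⟨μ, hμ, x, hx, rfl⟩)
  choose lam hlam x hx hxz using hz
  refine ⟨lam, x, hlam, hx, ?_⟩
  convert! hzind using 1
  exact funext hxz

theorem fixedEigenvalueCondition_of_linearIndependent
    (hdim : (Module.finrank ℝ ↥(S.VstarG τ) : ℤ) = n - p) {lam : Fin p → ℝ}
    {x : Fin p → Fin n → ℝ} (hx : ∀ j, x j ∈ (S.removeOutput j).RstarAt (lam j))
    (hind : LinearIndependent ℝ ((S.VstarG τ).mkQ ∘ x)) : S.FixedEigenvalueCondition τ lam := by
  intro T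
  have h1 := Submodule.finrank_map_add_finrank_ker_of_le (S.VstarG τ).mkQ
    (N := S.VstarG τ ⊔ ⨆ j ∈ T, (S.removeOutput j).RstarAt (lam j))
    ((S.VstarG τ).ker_mkQ.le.trans le_sup_left)
  rw [(S.VstarG τ).ker_mkQ] at h1
  have h2 := Finset.card_le_finrank_map hind (T := T)
    (N := S.VstarG τ ⊔ ⨆ j ∈ T, (S.removeOutput j).RstarAt (lam j))
    fun j hj => Submodule.mem_sup_right
      (Submodule.mem_iSup_of_mem j (Submodule.mem_iSup_of_mem hj (hx j)))
  omega

theorem exists_solves_of_linearIndependent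
    (hdim : (Module.finrank ℝ ↥(S.VstarG τ) : ℤ) = n - p) {ρ : ℝ} {lam : Fin p → ℝ}
    (hlam : ∀ j, τ.IsRate (lam j) ∧ lam j ≤ ρ)
    {x : Fin p → Fin n → ℝ} (hx : ∀ j, x j ∈ (S.removeOutput j).RstarAt (lam j))
    (hind : LinearIndependent ℝ ((S.VstarG τ).mkQ ∘ x)) :
    ∃ F, AsymptoticallyStable τ (S.closedA F) ∧ S.HasSingleModeOutputs τ ρ F := by
  obtain ⟨F₀, hF₀, hst⟩ := S.exists_isStabilisingFriend_VstarG τ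
  choose w hw₁ hw₂ using hx
  have hcard : Fintype.card (Fin p) = Module.finrank ℝ ((Fin n → ℝ) ⧸ S.VstarG τ) := by
    have h1 := (S.VstarG τ).finrank_quotient_add_finrank
    rw [Module.finrank_fin_fun] at h1
    rw [Fintype.card_fin]
    omega
  have hspan := hind.span_eq_top_of_card_eq_finrank' hcard
  let b := Module.Basis.mk hind hspan.ge
  -- The correction factors through the quotient, so the feedback stays `F₀` on `V*_g` while its
  -- value at each `x j` is free.
  let h : (Fin n → ℝ) →ₗ[ℝ] (Fin m → ℝ) :=
    (b.constr ℝ fun j => w j - F₀ *ᵥ x j).comp (S.VstarG τ).mkQ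
  have hhV : ∀ v ∈ S.VstarG τ, h v = 0 := fun v hv => by
    simp only [h, LinearMap.comp_apply]
    rw [Submodule.mkQ_apply, (Submodule.Quotient.mk_eq_zero _).2 hv, map_zero]
  have hhx : ∀ j, h (x j) = w j - F₀ *ᵥ x j := fun j => by
    have hb : (S.VstarG τ).mkQ (x j) = b j := by simp [b]
    simp only [h, LinearMap.comp_apply]
    rw [hb, Module.Basis.constr_basis]
  set F := F₀ + LinearMap.toMatrix' h with hFdef
  have hF : ∀ v, F *ᵥ v = F₀ *ᵥ v + h v := fun v => by
    simp only [hFdef, add_mulVec, LinearMap.toMatrix'_mulVec]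
  have hFV : ∀ v ∈ S.VstarG τ, F *ᵥ v = F₀ *ᵥ v := fun v hv => by
    rw [hF, hhV v hv, add_zero]
  have hFx : ∀ j, F *ᵥ x j = w j := fun j => by
    rw [hF, hhx, add_sub_cancel]
  have hAV : ∀ v ∈ S.VstarG τ, S.closedA F *ᵥ v = S.closedA F₀ *ᵥ v := fun v hv => by
    rw [closedA_mulVec, closedA_mulVec, hFV v hv]
  have hCV : ∀ v ∈ S.VstarG τ, S.closedC F *ᵥ v = 0 := fun v hv => by
    rw [closedC_mulVec, hFV v hv, ← closedC_mulVec]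
    exact (isFriend_iff.1 hF₀ v hv).2
  have hAx : ∀ j, S.closedA F *ᵥ x j = lam j • x j := fun j => by
    have h1 : S.A *ᵥ x j - lam j • x j + S.B *ᵥ w j = 0 := by
      have h2 := hw₁ j
      rwa [sub_mulVec, smul_mulVec, one_mulVec] at h2
    rw [closedA_mulVec, hFx, ← sub_eq_zero, ← h1]
    abel
  have hCx : ∀ j k, k ≠ j → S.closedOutput F k (x j) = 0 := fun j k hk => by
    rw [closedOutput_apply, closedC_mulVec, hFx]
    exact congrFun (hw₂ j) ⟨k, hk⟩
  have htop : ∀ P : Submodule ℝ (Fin n → ℝ), S.VstarG τ ≤ P → (∀ j, x j ∈ P) → P = ⊤ := by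
    intro P hVP hxP
    have h1 : P.map (S.VstarG τ).mkQ = ⊤ := by
      rw [eq_top_iff, ← hspan, Submodule.span_le]
      rintro _ ⟨j, rfl⟩
      exact Submodule.mem_map_of_mem (hxP j)
    have h2 := Submodule.comap_map_mkQ (S.VstarG τ) P
    rw [h1, Submodule.comap_top, sup_eq_right.2 hVP] at h2
    exact h2.symm
  refine ⟨F, asymptoticallyStable_iff.2 (htop _ ?_ ?_), fun k =>
    ⟨lam k, (hlam k).1, (hlam k).2, fun v => ?_⟩⟩
  · intro v hv
    obtain ⟨q, hq, h0⟩ := Module.End.mem_torsionAt.1 (hst hv)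
    refine Module.End.mem_torsionAt.2 ⟨q, hq, ?_⟩
    have h1 := Module.End.aeval_apply_sub_mem (f := (S.closedA F).mulVecLin) (W := ⊥) hF₀.1
      (by simp) (fun u hu => (Submodule.mem_bot ℝ).2 (sub_eq_zero.2 (hAV u hu))) q hv
    rwa [h0, sub_zero, Submodule.mem_bot] at h1
  · exact fun j => (hlam j).1.mem_torsionAt (hAx j)
  -- The eigenfunctional identity is linear, hence checked on `V*_g` and the `x j`: both sides
  -- vanish except at `x k`, where the eigenvalue is `lam k`.
  · have h1 := htop (LinearMap.ker ((S.closedOutput F k).comp (S.closedA F).mulVecLin -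
      lam k • S.closedOutput F k)) (fun u hu => ?_) (fun j => ?_)
    · have h2 : v ∈ LinearMap.ker ((S.closedOutput F k).comp (S.closedA F).mulVecLin -
        lam k • S.closedOutput F k) := h1 ▸ Submodule.mem_top
      exact sub_eq_zero.1 h2
    · have h2 : S.closedA F *ᵥ u ∈ S.VstarG τ := by
        rw [hAV u hu]
        exact (isFriend_iff.1 hF₀ u hu).1
      have h3 : ∀ u ∈ S.VstarG τ, S.closedOutput F k u = 0 := fun u hu =>
        congrFun (hCV u hu) k
      simp [h3 u hu, h3 _ h2]
    · rcases eq_or_ne k j with rfl | hk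
      · simp [hAx]
      · simp [hAx, hCx j k hk]

theorem StructuralCondition.globalMonotonicitySolvable
    (hdim : (Module.finrank ℝ ↥(S.VstarG τ) : ℤ) = n - p) (h : S.StructuralCondition τ) :
    S.GlobalMonotonicitySolvable τ := by
  intro ρ hρ
  obtain ⟨lam, x, hlam, hx, hind⟩ := h.exists_linearIndependent hdim
    (L := fun _ => {μ | τ.IsRate μ ∧ μ < ρ}) fun _ => τ.isRate_infinite_of_lt hρ
  obtain ⟨F, hF⟩ := exists_solves_of_linearIndependent hdim (ρ := ρ)
    (fun j => ⟨(hlam j).1, (hlam j).2.le⟩) hx hind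
  exact ⟨F, (solvesGlobalMonotonicity_iff hρ).2 hF⟩

theorem GlobalMonotonicitySolvable.structuralCondition
    (hdim : (Module.finrank ℝ ↥(S.VstarG τ) : ℤ) = n - p) (h : S.GlobalMonotonicitySolvable τ) :
    S.StructuralCondition τ := by
  -- These friends are fixed before the rate, so only finitely many eigenvalues have to be avoided.
  choose F' hF' using fun j => (S.removeOutput j).exists_isFriend_Vstar
  obtain ⟨ρ, hρ, hfin⟩ := τ.exists_isRate_forall_notMem (Set.finite_iUnion fun j =>
    Module.End.finite_hasEigenvalue ((S.removeOutput j).closedA (F' j)).mulVecLin)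
  obtain ⟨F, hF⟩ := h ρ hρ
  obtain ⟨hst, hmode⟩ := (solvesGlobalMonotonicity_iff hρ).1 hF
  choose μ hμ hμρ hmode using hmode
  set g := (S.closedC F).mulVecLin with hg
  have hfr : S.IsFriend (LinearMap.ker g) F := by
    refine isFriend_iff.2 fun v hv => ⟨?_, hv⟩
    have hv' : S.closedC F *ᵥ v = 0 := hv
    refine LinearMap.mem_ker.2 (funext fun k => ?_)
    have h1 := hmode k v
    rw [closedOutput_apply, closedOutput_apply, hv', Pi.zero_apply, mul_zero] at h1
    exact h1
  have hle : LinearMap.ker g ≤ S.VstarG τ := IsStabilisingFriend.le_VstarG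
    ⟨hfr, (asymptoticallyStable_iff.1 hst).symm ▸ le_top⟩
  have hrank := LinearMap.finrank_range_add_finrank_ker g
  rw [Module.finrank_fin_fun] at hrank
  have hrange : Module.finrank ℝ (LinearMap.range g) ≤ p := by
    simpa using Submodule.finrank_le (LinearMap.range g)
  have hmono := Submodule.finrank_mono hle
  -- The kernel has dimension at least `n - p`, that of the space `V*_g` containing it; so they
  -- coincide and `g` has full rank `p`.
  have hker : LinearMap.ker g = S.VstarG τ := Submodule.eq_of_le_of_finrank_eq hle (by omega)
  have hsurj : LinearMap.range g = ⊤ := Submodule.eq_top_of_finrank_eq (by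
    rw [Module.finrank_fin_fun]
    omega)
  choose x hx using fun k : Fin p => LinearMap.range_eq_top.1 hsurj (Pi.single k 1)
  have hind : LinearIndependent ℝ (g ∘ x) := by
    convert! (Pi.basisFun ℝ (Fin p)).linearIndependent using 1
    ext k
    simp [hx]
  have hmem : ∀ k, x k ∈ S.VstarG τ ⊔ (S.removeOutput k).Rstar := by
    intro k
    set Sk := S.removeOutput k
    set M := S.VstarG τ ⊔ Sk.Rstar with hM
    have hAx : S.closedA F *ᵥ x k - μ k • x k ∈ S.VstarG τ := by
      rw [← hker, LinearMap.mem_ker, map_sub, map_smul, sub_eq_zero]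
      ext i
      have h1 := hmode i (x k)
      have h2 : S.closedC F *ᵥ x k = Pi.single k 1 := hx k
      rw [closedOutput_apply, closedOutput_apply, h2] at h1
      rw [hx k]
      refine h1.trans ?_
      rcases eq_or_ne i k with rfl | hik
      · simp
      · simp [hik]
    -- Among the outputs `x k` is seen only by the `k`-th, so adjoining it keeps `F` a friend once
    -- that output is removed.
    have hW : Sk.IsFriend (S.VstarG τ ⊔ Submodule.span ℝ {x k}) F := by
      refine ⟨?_, ?_⟩
      · suffices h1 : S.VstarG τ ⊔ Submodule.span ℝ {x k} ≤
            (S.VstarG τ ⊔ Submodule.span ℝ {x k}).comap (S.closedA F).mulVecLin from h1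
        refine sup_le (fun v hv => ?_) ?_
        · rw [← hker] at hv ⊢
          exact Submodule.mem_sup_left (hfr.1 v hv)
        · rw [Submodule.span_singleton_le_iff_mem]
          have h1 := Submodule.add_mem_sup hAx
            (Submodule.smul_mem _ (μ k) (Submodule.mem_span_singleton_self (x k)))
          rw [sub_add_cancel] at h1
          exact h1
      · refine sup_le (hker ▸ (hfr.removeOutput k).2) ?_
        rw [Submodule.span_singleton_le_iff_mem, LinearMap.mem_ker]
        ext ⟨i, hi⟩
        have h1 : S.closedC F *ᵥ x k = Pi.single k 1 := hx k
        have h2 := congrFun h1 i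
        rw [Pi.single_eq_of_ne hi, closedC_mulVec] at h2
        rw [mulVecLin_apply, closedC_mulVec]
        exact h2
    -- Replacing `F` by `F' k` changes the dynamics only by vectors of `R*_k`, which `M` absorbs.
    have hsub : ∀ v ∈ S.VstarG τ ⊔ Submodule.span ℝ {x k},
        Sk.closedA (F' k) *ᵥ v - S.closedA F *ᵥ v ∈ M := fun v hv =>
      Submodule.mem_sup_right (Sk.map_nullInputs_le_Rstar
        (hW.closedA_mulVec_sub_mem (hF' k) hW.le_Vstar hv))
    set f : Module.End ℝ (Fin n → ℝ) := (Sk.closedA (F' k)).mulVecLin with hf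
    have hMinv : M ≤ M.comap f := by
      refine sup_le (fun v hv => ?_) (fun v hv => ?_)
      · have h1 := hsub v (Submodule.mem_sup_left hv)
        have h2 : S.closedA F *ᵥ v ∈ M := by
          rw [← hker] at hv
          exact Submodule.mem_sup_left (hker ▸ hfr.1 v hv)
        have h3 := M.add_mem h1 h2
        rwa [sub_add_cancel] at h3
      · exact Submodule.mem_sup_right ((hF' k).closedA_mulVec_mem_Rstar hv)
    have hfx : f (x k) - μ k • x k ∈ M := by
      have h1 := M.add_mem
        (hsub (x k) (Submodule.mem_sup_right (Submodule.mem_span_singleton_self _)))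
        (Submodule.mem_sup_left hAx)
      rwa [sub_add_sub_cancel] at h1
    have hne : ¬ f.HasEigenvalue (μ k) := fun hev =>
      hfin (μ k) (hμ k) (hμρ k) (Set.mem_iUnion.2 ⟨k, hev⟩)
    let e : Module.End ℝ (Fin n → ℝ) := f - μ k • 1
    have hinj : Function.Injective e := by
      rw [← LinearMap.ker_eq_bot]
      rw [Module.End.hasEigenvalue_iff, Module.End.eigenspace_def, not_not] at hne
      simpa [e, Algebra.algebraMap_eq_smul_one] using hne
    have heM : ∀ v ∈ M, e v ∈ M := fun v hv =>
      M.sub_mem (hMinv hv) (M.smul_mem _ hv)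
    have hsurjM : Function.Surjective (e.restrict heM) :=
      LinearMap.surjective_of_injective fun a b hab =>
        Subtype.ext (hinj (congrArg Subtype.val hab))
    -- The shift `e` is injective and maps the finite-dimensional `M` onto itself; as `e (x k)` lies
    -- in `M`, so does its unique preimage `x k`.
    obtain ⟨y, hy⟩ := hsurjM ⟨e (x k), hfx⟩
    have : (y : Fin n → ℝ) = x k := hinj (congrArg Subtype.val hy)
    exact this ▸ y.2
  intro T
  have h1 := Submodule.finrank_map_add_finrank_ker_of_le g
    (N := S.VstarG τ ⊔ ⨆ j ∈ T, (S.removeOutput j).Rstar) (hle.trans le_sup_left)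
  have h2 := Finset.card_le_finrank_map hind (T := T)
    (N := S.VstarG τ ⊔ ⨆ j ∈ T, (S.removeOutput j).Rstar) fun j hj =>
      sup_le_sup_left (le_iSup₂ (f := fun j (_ : j ∈ T) => (S.removeOutput j).Rstar) j hj)
        (S.VstarG τ) (hmem j)
  rw [hker] at h1
  omega

/-- A box around an interior point is a product of infinite sets of candidate eigenvalues, so it
contains a tuple for which the condition holds. -/
theorem StructuralCondition.interior_eq_empty
    (hdim : (Module.finrank ℝ ↥(S.VstarG τ) : ℤ) = n - p) (h : S.StructuralCondition τ) :
    interior {lam | lam ∈ S.admissibleTuples τ ∧ ¬ S.FixedEigenvalueCondition τ lam} = ∅ := by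
  rw [Set.eq_empty_iff_forall_notMem]
  intro lam₀ hlam₀
  obtain ⟨ε, hε, hball⟩ := Metric.isOpen_iff.1 isOpen_interior lam₀ hlam₀
  obtain ⟨lam, x, hlam, hx, hind⟩ := h.exists_linearIndependent hdim
    (L := fun j => Set.Ioo (lam₀ j - ε) (lam₀ j + ε)) fun j => Set.Ioo_infinite (by linarith)
  have hmem : lam ∈ Metric.ball lam₀ ε := by
    rw [Metric.mem_ball, dist_pi_lt_iff hε]
    intro j
    rw [← Metric.mem_ball, Real.ball_eq_Ioo]
    exact hlam j
  exact (interior_subset (hball hmem)).2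
    (fixedEigenvalueCondition_of_linearIndependent hdim hx hind)

end LTISystem

theorem theorem2 {n m p : ℕ} (τ : TimeDomain) (S : LTISystem n m (Fin p))
    (hright : S.RightInvertible)
    (hstab : S.Stabilisable τ)
    (hzero : ¬ S.IsInvariantZero τ.constantFrequency)
    (hdistinct : ∀ z ∈ τ.stableRegion, S.IsInvariantZero z → S.zeroMultiplicity z = 1)
    (hdim : (Module.finrank ℝ ↥(S.VstarG τ) : ℤ) = n - p) :
    (S.GlobalMonotonicitySolvable τ ↔ S.StructuralCondition τ) ∧
    (S.StructuralCondition τ →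
      interior {lam | lam ∈ S.admissibleTuples τ ∧ ¬ S.FixedEigenvalueCondition τ lam} = ∅) :=
  ⟨⟨fun h => h.structuralCondition hdim, fun h => h.globalMonotonicitySolvable hdim⟩,
    fun h => h.interior_eq_empty hdim⟩
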